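/- Let $\lambda_1,\lambda_3,\lambda_{p_2},\bar m,\sigma,\beta,P_1,P_2,P_3>0$. Let $\Phi_1,\Phi_2,\Phi_3$ be independent point processes in $\mathbb{R}^2$, where $\Phi_1$ and $\Phi_3$ are homogeneous Poisson point processes with intensities $\lambda_1$ and $\lambda_3$, and $\Phi_2=\bigcup_i (X_i+\Psi_i)$ is a Thomas cluster process: $\{X_i\}$ is a homogeneous Poisson point process of intensity $\lambda_{p_2}$ and, independently of it, the $\Psi_i$ are independent Poisson point processes with intensity function $\bar m\, e^{-\|y\|^2/(2\sigma^2)}/(2\pi\sigma^2)$. Let $R_l=\min_{x\in\Phi_l}\|x\|$ be the contact distance of tier $l$ and $C_l=P_lR_l^{-\beta}$ the maximum power received at the origin from tier $l$. Put $I_0(z)=\pi^{-1}\int_0^\pi e^{z\cos\phi}\,d\phi$, $q(a,b)=b\,e^{-(a^2+b^2)/2}I_0(ab)$, $Q_1(a,b)=\int_b^\infty z\,e^{-(z^2+a^2)/2}I_0(az)\,dz$, let $f_l(r)=2\pi\lambda_l r\,e^{-\pi\lambda_l r^2}$ for $l\in\{1,3\}$, and $$f_2(r)=\int_0^\infty \bar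 m\lambda_{p_2}2\pi\tfrac{z}{\sigma}\,q\!\left(\tfrac z\sigma,\tfrac r\sigma\right)e^{-\bar m(1-Q_1(z/\sigma,\,r/\sigma))}\,dz\cdot\exp\!\left(-\int_0^\infty 2\pi\lambda_{p_2}z\left(1-e^{-\bar m(1-Q_1(z/\sigma,\,r/\sigma))}\right)dz\right).$$ Then, for pairwise distinct $i,j,k\in\{1,2,3\}$, $$\mathbb{P}(C_i>C_j>C_k)=\int_0^\infty\int_{(P_j/P_i)^{1/\beta}r_i}^\infty\int_{(P_k/P_j)^{1/\beta}r_j}^\infty f_k(r_k)\,f_j(r_j)\,f_i(r_i)\,dr_k\,dr_j\,dr_i ,$$ where all the integrals (those over $z$ for every $r>0$, and the triple integral) converge absolutely. -/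

import Mathlib

open MeasureTheory ProbabilityTheory Set

noncomputable section

namespace HetNet

/-- The Euclidean plane, the location space of all nodes. -/
abbrev Plane : Type := EuclideanSpace ℝ (Fin 2)

/-- A point configuration: a locally finite subset of the plane. -/
structure Configuration where
  /-- the set of points -/
  points : Set Plane
  /-- every bounded region holds finitely many of them -/
  locallyFinite : ∀ r : ℝ, (points ∩ Metric.closedBall 0 r).Finite

/-- The number of points of a configuration in `A`. -/
def Configuration.count (φ : Configuration) (A : Set Plane) : ℕ∞ :=
  (φ.points ∩ A).encard

/-- The usual σ-algebra on configurations, generated by the counts in Borel sets. A point process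
is a measurable map into `Configuration`. -/
instance : MeasurableSpace Configuration :=
  ⨆ (A : Set Plane) (_ : MeasurableSet A),
    MeasurableSpace.comap (fun φ : Configuration => φ.count A) inferInstance

/-- The contact distance of a configuration: the distance from the origin, where the typical user
is located, to the closest point. -/
def Configuration.contactDistance (φ : Configuration) : ℝ :=
  Metric.infDist 0 φ.points

/-- `Φ` is a Poisson point process with intensity measure `Λ`: the count in a set `A` of finite
intensity is Poisson distributed with mean `Λ A`, and counts in disjoint sets are independent. -/
structure IsPoissonProcess {Ω : Type*} [MeasurableSpace Ω] (Φ : Ω → Configuration)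
    (Λ : Measure Plane) (μ : Measure Ω) : Prop where
  measurable : Measurable Φ
  law_count : ∀ A : Set Plane, MeasurableSet A → Λ A ≠ ⊤ →
    μ.map (fun ω => (Φ ω).count A) =
      (poissonMeasure (Λ A).toNNReal).map (fun n : ℕ => (n : ℕ∞))
  indep_count : ∀ (n : ℕ) (A : Fin n → Set Plane), (∀ i, MeasurableSet (A i)) →
    (∀ i j, i ≠ j → Disjoint (A i) (A j)) →
    iIndepFun (fun i ω => (Φ ω).count (A i)) μ

/-- `Φ` is a homogeneous Poisson point process in the plane with intensity `lam`. -/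
def IsHomogeneousPoisson {Ω : Type*} [MeasurableSpace Ω] (Φ : Ω → Configuration)
    (lam : ℝ) (μ : Measure Ω) : Prop :=
  IsPoissonProcess Φ (ENNReal.ofReal lam • volume) μ

/-- The displacement kernel: the isotropic centred Gaussian density with variance `σ ^ 2` in each
coordinate. -/
def displacementKernel (σ : ℝ) (y : Plane) : ℝ :=
  Real.exp (-‖y‖ ^ 2 / (2 * σ ^ 2)) / (2 * Real.pi * σ ^ 2)

/-- `Φ` is a Thomas cluster process with parent intensity `lamP`, mean number `m` of daughter
points per parent and displacement variance `σ ^ 2`: almost surely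
`Φ = ⋃ i, (X i + Ψ i)`, where `X 0, X 1, …` are the distinct points of a homogeneous Poisson process
of intensity `lamP`, and the clusters `Ψ i` are Poisson processes with intensity function
`m * displacementKernel σ`, independent of each other and of the parent points. -/
def IsThomasProcess {Ω : Type*} [MeasurableSpace Ω] (Φ : Ω → Configuration)
    (lamP m σ : ℝ) (μ : Measure Ω) : Prop :=
  Measurable Φ ∧
  ∃ (Φp : Ω → Configuration) (X : ℕ → Ω → Plane) (Ψ : ℕ → Ω → Configuration),
    IsHomogeneousPoisson Φp lamP μ ∧
    (∀ i, Measurable (X i)) ∧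
    (∀ᵐ ω ∂μ, Function.Injective (fun i => X i ω) ∧ range (fun i => X i ω) = (Φp ω).points) ∧
    (∀ i, IsPoissonProcess (Ψ i)
      (volume.withDensity (fun y => ENNReal.ofReal (m * displacementKernel σ y))) μ) ∧
    iIndepFun Ψ μ ∧
    IndepFun (fun ω i => X i ω) (fun ω i => Ψ i ω) μ ∧
    ∀ᵐ ω ∂μ, (Φ ω).points = ⋃ i, (fun y => X i ω + y) '' (Ψ i ω).points

/-- The three tiers of the network: tier 1 (cache-enabled users, D2D), tier 2 (small base
stations), tier 3 (macro base stations). -/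
inductive Tier : Type
  | one
  | two
  | three

/-- The maximum power received by the typical user from a tier with transmit power `p`, when `φ` is
the configuration of the tier and `β` the path-loss exponent. -/
def maxPower (p β : ℝ) (φ : Configuration) : ℝ :=
  p * φ.contactDistance ^ (-β)

/-- The modified Bessel function of the first kind of order zero. -/
def besselI0 (z : ℝ) : ℝ :=
  Real.pi⁻¹ * ∫ φ in (0 : ℝ)..Real.pi, Real.exp (z * Real.cos φ)

/-- The density at `b` of the Rician distribution with parameters `a` and `1`. -/
def riceDensity (a b : ℝ) : ℝ :=
  b * Real.exp (-(b ^ 2 + a ^ 2) / 2) * besselI0 (a * b)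

/-- The first-order Marcum Q-function. -/
def marcumQ (a b : ℝ) : ℝ :=
  ∫ z in Ioi b, z * Real.exp (-(z ^ 2 + a ^ 2) / 2) * besselI0 (a * z)

/-- The integrand of the prefactor in the contact distance density of a Thomas process. -/
def thomasPrefactorIntegrand (lamP m σ r z : ℝ) : ℝ :=
  m * lamP * (2 * Real.pi) * (z / σ) * riceDensity (z / σ) (r / σ) *
    Real.exp (-m * (1 - marcumQ (z / σ) (r / σ)))

/-- The integrand of the exponent in the contact distance density of a Thomas process. -/
def thomasExponentIntegrand (lamP m σ r z : ℝ) : ℝ :=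
  2 * Real.pi * lamP * z * (1 - Real.exp (-m * (1 - marcumQ (z / σ) (r / σ))))

/-- The contact distance density of a Thomas process. -/
def thomasContactDensity (lamP m σ r : ℝ) : ℝ :=
  (∫ z in Ioi 0, thomasPrefactorIntegrand lamP m σ r z) *
    Real.exp (-∫ z in Ioi 0, thomasExponentIntegrand lamP m σ r z)

/-- The contact distance density of a homogeneous Poisson process (a Rayleigh density). -/
def poissonContactDensity (lam r : ℝ) : ℝ :=
  2 * Real.pi * lam * r * Real.exp (-Real.pi * lam * r ^ 2)

/-- The contact distance density of each tier. -/
def contactDensity (lam₁ lam₃ lamP m σ : ℝ) : Tier → ℝ → ℝ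
  | Tier.one => poissonContactDensity lam₁
  | Tier.two => thomasContactDensity lamP m σ
  | Tier.three => poissonContactDensity lam₃

end HetNet

end

/-!
The event is decided by the three contact distances alone: almost surely they are positive, and then
`C i > C j > C k` says that `(R i, R j, R k)` lies in the region over which the triple integral is
taken (`orderedRegion`). The tiers are independent, so it is enough to show that each contact
distance has the stated density on `(0, ∞)`, and then to apply Fubini's theorem.

For this, the contact distance of a nonempty configuration is at least `r` if and only if the open
ball of radius `r` around the origin contains no point (`le_contactDistance_iff`), so its survival
function is a void probability. For a Poisson process, that is `exp (-π λ r ^ 2)`. For a Thomas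
process, given the parents `X i`, the independent clusters avoid the ball with probability
`exp (-∑ i, κ (B(-X i, r)))`, where `κ` is the intensity measure of a cluster. The expectation of
this is a value of the Laplace functional of the parent process
(`IsPoissonProcess.lintegral_negExp_tsum`), namely `exp (-lamP * ∫ x, (1 - exp (-κ (B(-x, r)))))`.
The Laplace functional is obtained from the Laplace transform of the Poisson law by independence of
the counts in the level sets of a simple function, and by monotone approximation. The exponential
`negExp` on `[0, ∞]` makes the argument free of finiteness conditions on the sum over the parents.

In polar coordinates, the angular integral of the Gaussian kernel is a Bessel function, which gives
`κ (B(-x, r)) = m * (1 - Q₁(‖x‖ / σ, r / σ))` (`clusterIntensity_ball`), and so the exponent is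
`∫ z, thomasExponentIntegrand lamP m σ r z`. It is differentiated under the integral sign with the
Gaussian bound `abs_riceDensity_le`; the derivative is the prefactor of the Thomas density
(`hasDerivAt_integral_thomasExponentIntegrand`). It tends to infinity with `r`, hence the process is
almost surely not empty and the density has total mass one.
-/

namespace HetNet
open scoped ENNReal NNReal Topology
open Filter

/-! ### The exponential of a negative extended real -/

/-- The map `t ↦ exp (-t)` on `[0, ∞]`, with `exp (-∞) = 0`. -/
noncomputable def negExp (t : ℝ≥0∞) : ℝ≥0∞ := EReal.exp (-(t : EReal))

lemma negExp_zero : negExp 0 = 1 := by simp [negExp]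

lemma negExp_top : negExp ∞ = 0 := by simp [negExp]

lemma negExp_ofReal {t : ℝ} (ht : 0 ≤ t) :
    negExp (ENNReal.ofReal t) = ENNReal.ofReal (Real.exp (-t)) := by
  rw [negExp, EReal.coe_ennreal_ofReal, max_eq_left ht, ← EReal.coe_neg, EReal.exp_coe]

lemma negExp_eq_ofReal {t : ℝ≥0∞} (ht : t ≠ ∞) :
    negExp t = ENNReal.ofReal (Real.exp (-t.toReal)) := by
  rw [← negExp_ofReal ENNReal.toReal_nonneg, ENNReal.ofReal_toReal ht]

lemma negExp_add (s t : ℝ≥0∞) : negExp (s + t) = negExp s * negExp t := by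
  rw [negExp, negExp, negExp, EReal.coe_ennreal_add, EReal.neg_add, sub_eq_add_neg, EReal.exp_add]
  · left; simp
  · right; simp

lemma negExp_sum {ι : Type*} (s : Finset ι) (f : ι → ℝ≥0∞) :
    negExp (∑ i ∈ s, f i) = ∏ i ∈ s, negExp (f i) := by
  induction s using Finset.cons_induction with
  | empty => simp [negExp_zero]
  | cons j s hj ih => rw [Finset.sum_cons, Finset.prod_cons, negExp_add, ih]

lemma negExp_mul_nat (t : ℝ≥0∞) (n : ℕ) : negExp (t * n) = negExp t ^ n := by
  have := negExp_sum (Finset.range n) (fun _ => t)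
  simpa [mul_comm] using this

lemma antitone_negExp : Antitone negExp := fun _ _ h =>
  EReal.exp_monotone (EReal.neg_le_neg_iff.2 (EReal.coe_ennreal_le_coe_ennreal_iff.2 h))

lemma negExp_le_one (t : ℝ≥0∞) : negExp t ≤ 1 := by
  rw [← negExp_zero]; exact antitone_negExp zero_le

lemma continuous_negExp : Continuous negExp :=
  ENNReal.continuous_exp.comp (continuous_neg.comp continuous_coe_ennreal_ereal)

/-! ### The Laplace functional of a Poisson process -/

/-- The Laplace transform of the Poisson distribution. -/
lemma lintegral_negExp_poissonMeasure (r : ℝ≥0) (a : ℝ≥0∞) :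
    ∫⁻ n : ℕ, negExp (a * n) ∂poissonMeasure r = negExp ((1 - negExp a) * r) := by
  obtain ⟨q, hq0, hq1, hq⟩ : ∃ q : ℝ, 0 ≤ q ∧ q ≤ 1 ∧ negExp a = ENNReal.ofReal q := by
    have h1 := negExp_le_one a
    have h2 : negExp a ≠ ∞ := ne_top_of_le_ne_top ENNReal.one_ne_top h1
    refine ⟨(negExp a).toReal, ENNReal.toReal_nonneg, ?_, (ENNReal.ofReal_toReal h2).symm⟩
    exact ENNReal.toReal_le_of_le_ofReal zero_le_one (by simpa using h1)
  have hs : HasSum (fun n : ℕ => Real.exp (-r) * ((r : ℝ) * q) ^ n / n.factorial)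
      (Real.exp (-((1 - q) * r))) := by
    have h := (NormedSpace.expSeries_div_hasSum_exp ((r : ℝ) * q)).mul_left (Real.exp (-r))
    rw [← Real.exp_eq_exp_ℝ, ← Real.exp_add] at h
    have he : -((1 - q) * (r : ℝ)) = -r + r * q := by ring
    simpa only [he, mul_div_assoc] using h
  have h1 : (1 - negExp a) * (r : ℝ≥0∞) = ENNReal.ofReal ((1 - q) * r) := by
    rw [hq, ENNReal.ofReal_mul (by linarith), ENNReal.ofReal_sub _ hq0]
    simp
  rw [h1, negExp_ofReal (mul_nonneg (sub_nonneg.2 hq1) r.coe_nonneg), ← hs.tsum_eq,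
    ENNReal.ofReal_tsum_of_nonneg (fun n => by positivity) hs.summable, poissonMeasure,
    lintegral_sum_measure]
  refine tsum_congr fun n => ?_
  rw [lintegral_smul_measure, lintegral_dirac, negExp_mul_nat, hq, ← ENNReal.ofReal_pow hq0,
    smul_eq_mul, ← ENNReal.ofReal_mul (by positivity)]
  congr 1
  rw [mul_pow]; ring

lemma measurable_count {A : Set Plane} (hA : MeasurableSet A) :
    Measurable (fun φ : Configuration => φ.count A) := by
  rw [measurable_iff_comap_le]
  exact le_iSup₂ (f := fun (A : Set Plane) (_ : MeasurableSet A) =>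
    MeasurableSpace.comap (fun φ : Configuration => φ.count A) inferInstance) A hA

/-- The random measure which puts a unit mass on every term of a sequence of points. -/
noncomputable def sumDirac (x : ℕ → Plane) : Measure Plane :=
  Measure.sum fun i => Measure.dirac (x i)

lemma lintegral_sumDirac (x : ℕ → Plane) (g : Plane → ℝ≥0∞) :
    ∫⁻ y, g y ∂sumDirac x = ∑' i, g (x i) := by
  simp [sumDirac, lintegral_sum_measure]

lemma sumDirac_apply {x : ℕ → Plane} {φ : Configuration} (hx : Function.Injective x)
    (hr : range x = φ.points) {A : Set Plane} (hA : MeasurableSet A) :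
    sumDirac x A = (φ.count A : ℝ≥0∞) := by
  have h1 : φ.count A = (x ⁻¹' A).encard := by
    rw [Configuration.count, ← hr, ← image_preimage_eq_range_inter, hx.injOn.encard_image]
  rw [h1, ← ENNReal.tsum_set_one, sumDirac, Measure.sum_apply _ hA,
    tsum_subtype (x ⁻¹' A) (fun _ => (1 : ℝ≥0∞))]
  refine tsum_congr fun i => ?_
  rw [Measure.dirac_apply' _ hA]
  rfl

variable {Ω : Type*} [MeasurableSpace Ω] {μ : Measure Ω} {Λ : Measure Plane}

lemma IsPoissonProcess.lintegral_negExp_count {Φ : Ω → Configuration}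
    (h : IsPoissonProcess Φ Λ μ) {A : Set Plane} (hA : MeasurableSet A) (hΛ : Λ A ≠ ∞)
    (a : ℝ≥0∞) :
    ∫⁻ ω, negExp (a * ((Φ ω).count A : ℝ≥0∞)) ∂μ = negExp ((1 - negExp a) * Λ A) := by
  have hm : Measurable fun n : ℕ∞ => negExp (a * (n : ℝ≥0∞)) := measurable_from_top
  have hc : Measurable fun ω => (Φ ω).count A := (measurable_count hA).comp h.measurable
  rw [← lintegral_map hm hc, h.law_count A hA hΛ, lintegral_map hm measurable_from_top]
  simp only [ENat.toENNReal_coe]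
  rw [lintegral_negExp_poissonMeasure, ENNReal.coe_toNNReal hΛ]

/-- The probability that a Poisson process leaves a set empty. -/
lemma IsPoissonProcess.measure_count_eq_zero {Φ : Ω → Configuration}
    (h : IsPoissonProcess Φ Λ μ) {A : Set Plane} (hA : MeasurableSet A) (hΛ : Λ A ≠ ∞) :
    μ {ω | (Φ ω).count A = 0} = negExp (Λ A) := by
  have hc : Measurable fun ω => (Φ ω).count A := (measurable_count hA).comp h.measurable
  -- Since `negExp (∞ * n)` is the indicator of `n = 0`, this is the Laplace transform at `∞`.
  have := h.lintegral_negExp_count hA hΛ ∞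
  rw [negExp_top, tsub_zero, one_mul] at this
  have hs : MeasurableSet {ω | (Φ ω).count A = 0} := hc (measurableSet_singleton 0)
  rw [← this, ← lintegral_indicator_one hs]
  refine lintegral_congr fun ω => ?_
  by_cases h0 : (Φ ω).count A = 0
  · simp [h0, negExp_zero]
  · simp [h0, negExp_top, ENNReal.top_mul]

/-- The Laplace functional of a Poisson process at a simple function supported in a set of finite
intensity: a finite product of Laplace transforms of independent counts. -/
lemma IsPoissonProcess.lintegral_negExp_simpleFunc {Φ : Ω → Configuration}
    (h : IsPoissonProcess Φ Λ μ) {X : ℕ → Ω → Plane}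
    (hX : ∀ᵐ ω ∂μ, Function.Injective (fun i => X i ω) ∧ range (fun i => X i ω) = (Φ ω).points)
    (f : SimpleFunc Plane ℝ≥0∞) (hf : ∀ a ≠ 0, Λ (f ⁻¹' {a}) ≠ ∞) :
    ∫⁻ ω, negExp (∑' i, f (X i ω)) ∂μ = negExp (∫⁻ x, (1 - negExp (f x)) ∂Λ) := by
  have hR : ∫⁻ x, (1 - negExp (f x)) ∂Λ = ∑ a ∈ f.range, (1 - negExp a) * Λ (f ⁻¹' {a}) := by
    rw [← SimpleFunc.map_lintegral (fun a => 1 - negExp a), ← SimpleFunc.lintegral_eq_lintegral]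
    rfl
  have hL : ∀ᵐ ω ∂μ, negExp (∑' i, f (X i ω)) =
      ∏ k : f.range, negExp (k.1 * ((Φ ω).count (f ⁻¹' {k.1}) : ℝ≥0∞)) := by
    filter_upwards [hX] with ω hω
    rw [← lintegral_sumDirac (fun i => X i ω), SimpleFunc.lintegral_eq_lintegral,
      SimpleFunc.lintegral, negExp_sum,
      Finset.prod_coe_sort f.range (fun a => negExp (a * ((Φ ω).count (f ⁻¹' {a}) : ℝ≥0∞)))]
    refine Finset.prod_congr rfl fun a _ => ?_
    rw [sumDirac_apply hω.1 hω.2 (f.measurableSet_fiber a)]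
  let e := f.range.equivFin
  have hind := (h.indep_count _ (fun k => f ⁻¹' {(e.symm k).1})
    (fun k => f.measurableSet_fiber _) (fun i j hij => Disjoint.preimage _ (by
      simpa [Subtype.val_inj] using hij))).comp
    (fun k n => negExp ((e.symm k).1 * (n : ℝ≥0∞))) (fun k => measurable_from_top)
  rw [lintegral_congr_ae hL, hR, negExp_sum]
  have h2 : ∀ ω, ∏ k : f.range, negExp (k.1 * ((Φ ω).count (f ⁻¹' {k.1}) : ℝ≥0∞)) =
      ∏ k, negExp ((e.symm k).1 * ((Φ ω).count (f ⁻¹' {(e.symm k).1}) : ℝ≥0∞)) := fun ω =>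
    (Equiv.prod_comp e.symm
      (fun k : f.range => negExp (k.1 * ((Φ ω).count (f ⁻¹' {k.1}) : ℝ≥0∞)))).symm
  simp_rw [h2]
  have h3 := lintegral_prod_eq_prod_lintegral_of_indepFun Finset.univ _ hind (fun k =>
    (show Measurable fun n : ℕ∞ => negExp ((e.symm k).1 * (n : ℝ≥0∞)) from
      measurable_from_top).comp
      ((measurable_count (f.measurableSet_fiber _)).comp h.measurable))
  refine h3.trans ?_
  rw [← Finset.prod_coe_sort f.range, ← Equiv.prod_comp e.symm]
  refine Finset.prod_congr rfl fun k _ => ?_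
  -- The level set of the value `0` may have infinite intensity, but contributes a factor `1`.
  by_cases hk : (e.symm k).1 = 0
  · have := hind.isProbabilityMeasure
    simp [hk, negExp_zero]
  · exact h.lintegral_negExp_count (f.measurableSet_fiber _) (hf _ hk) _

/-- The Laplace functional of a Poisson process, the points of which are enumerated by `X`. -/
theorem IsPoissonProcess.lintegral_negExp_tsum [SigmaFinite Λ] [IsProbabilityMeasure μ]
    {Φ : Ω → Configuration} (h : IsPoissonProcess Φ Λ μ) {X : ℕ → Ω → Plane}
    (hXm : ∀ i, Measurable (X i))
    (hX : ∀ᵐ ω ∂μ, Function.Injective (fun i => X i ω) ∧ range (fun i => X i ω) = (Φ ω).points)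
    {g : Plane → ℝ≥0∞} (hg : Measurable g) :
    ∫⁻ ω, negExp (∑' i, g (X i ω)) ∂μ = negExp (∫⁻ x, (1 - negExp (g x)) ∂Λ) := by
  -- Simple functions increase to `g`; cutting them off keeps the level sets of finite intensity.
  let S := spanningSets Λ
  have hS : ∀ n, MeasurableSet (S n) := measurableSet_spanningSets Λ
  let f : ℕ → SimpleFunc Plane ℝ≥0∞ := fun n => (SimpleFunc.eapprox g n).restrict (S n)
  have hfx : ∀ n x, f n x = (S n).indicator (SimpleFunc.eapprox g n) x := fun n x =>
    SimpleFunc.restrict_apply _ (hS n) x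
  have hmono : ∀ x, Monotone fun n => f n x := fun x n k hnk => by
    simp only [hfx]
    exact (indicator_le_indicator_of_subset (monotone_spanningSets Λ hnk)
      (fun _ => zero_le) x).trans (indicator_le_indicator (SimpleFunc.monotone_eapprox g hnk x))
  have htend : ∀ x, Tendsto (fun n => f n x) atTop (𝓝 (g x)) := fun x => by
    have h1 : Tendsto (fun n => SimpleFunc.eapprox g n x) atTop (𝓝 (g x)) := by
      rw [← SimpleFunc.iSup_eapprox_apply hg x]
      exact tendsto_atTop_iSup fun n k hnk => SimpleFunc.monotone_eapprox g hnk x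
    refine h1.congr' ?_
    obtain ⟨N, hN⟩ : ∃ N, x ∈ S N := mem_iUnion.1 ((iUnion_spanningSets Λ).symm ▸ mem_univ x)
    filter_upwards [eventually_ge_atTop N] with n hn
    rw [hfx, indicator_of_mem (monotone_spanningSets Λ hn hN)]
  have hfin : ∀ n, ∀ a ≠ 0, Λ (f n ⁻¹' {a}) ≠ ∞ := fun n a ha => by
    refine ((measure_mono fun x hx => ?_).trans_lt (measure_spanningSets_lt_top Λ n)).ne
    by_contra hxS
    exact ha (by rw [← show f n x = a from hx, hfx, indicator_of_notMem hxS])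
  have hsum : ∀ ω, Tendsto (fun n => ∑' i, f n (X i ω)) atTop (𝓝 (∑' i, g (X i ω))) := fun ω => by
    simp_rw [← lintegral_sumDirac (fun i => X i ω)]
    exact lintegral_tendsto_of_tendsto_of_monotone (fun n => (f n).measurable.aemeasurable)
      (ae_of_all _ hmono) (ae_of_all _ htend)
  have hL : Tendsto (fun n => ∫⁻ ω, negExp (∑' i, f n (X i ω)) ∂μ) atTop
      (𝓝 (∫⁻ ω, negExp (∑' i, g (X i ω)) ∂μ)) := by
    refine tendsto_lintegral_of_dominated_convergence (fun _ => 1) (fun n => ?_)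
      (fun n => ae_of_all _ fun ω => negExp_le_one _) (by simp)
      (ae_of_all _ fun ω => (continuous_negExp.tendsto _).comp (hsum ω))
    exact continuous_negExp.measurable.comp
      (Measurable.tsum fun i => (f n).measurable.comp (hXm i))
  have hR : Tendsto (fun n => negExp (∫⁻ x, (1 - negExp (f n x)) ∂Λ)) atTop
      (𝓝 (negExp (∫⁻ x, (1 - negExp (g x)) ∂Λ))) := by
    refine (continuous_negExp.tendsto _).comp (lintegral_tendsto_of_tendsto_of_monotone
      (fun n => ?_) (ae_of_all _ fun x n k hnk => ?_) (ae_of_all _ fun x => ?_))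
    · exact (measurable_const.sub (continuous_negExp.measurable.comp (f n).measurable)).aemeasurable
    · exact tsub_le_tsub_left (antitone_negExp (hmono x hnk)) 1
    · exact ENNReal.Tendsto.sub tendsto_const_nhds ((continuous_negExp.tendsto _).comp (htend x))
        (Or.inl ENNReal.one_ne_top)
  refine tendsto_nhds_unique hL (hR.congr fun n => ?_)
  exact (h.lintegral_negExp_simpleFunc hX (f n) (hfin n)).symm

/-! ### The modified Bessel function and the Rician density -/

lemma continuous_besselI0 : Continuous besselI0 := by
  refine continuous_const.mul ?_
  exact intervalIntegral.continuous_parametric_intervalIntegral_of_continuous' (by fun_prop) _ _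

lemma besselI0_nonneg (z : ℝ) : 0 ≤ besselI0 z :=
  mul_nonneg (by positivity)
    (intervalIntegral.integral_nonneg Real.pi_pos.le fun _ _ => (Real.exp_pos _).le)

lemma besselI0_le_exp_abs (z : ℝ) : besselI0 z ≤ Real.exp |z| := by
  have h : ∫ φ in (0 : ℝ)..Real.pi, Real.exp (z * Real.cos φ) ≤
      ∫ _ in (0 : ℝ)..Real.pi, Real.exp |z| := by
    refine intervalIntegral.integral_mono_on Real.pi_pos.le
      (Continuous.intervalIntegrable (by fun_prop) _ _) (by simp) fun φ _ => ?_
    refine Real.exp_le_exp.2 ((le_abs_self _).trans ?_)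
    rw [abs_mul]
    exact mul_le_of_le_one_right (abs_nonneg z) (Real.abs_cos_le_one φ)
  rw [intervalIntegral.integral_const, smul_eq_mul, sub_zero] at h
  calc besselI0 z ≤ Real.pi⁻¹ * (Real.pi * Real.exp |z|) :=
        mul_le_mul_of_nonneg_left h (by positivity)
    _ = Real.exp |z| := by field_simp

lemma besselI0_neg (z : ℝ) : besselI0 (-z) = besselI0 z := by
  unfold besselI0
  congr 1
  have h := intervalIntegral.integral_comp_sub_left (a := 0) (b := Real.pi)
    (fun φ => Real.exp (z * Real.cos φ)) Real.pi
  simpa [Real.cos_pi_sub] using h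

/-- The angular integral over a full period gives the Bessel function. -/
lemma integral_exp_mul_cos_sub (c α : ℝ) :
    ∫ θ in (-Real.pi)..Real.pi, Real.exp (c * Real.cos (θ - α)) = 2 * Real.pi * besselI0 c := by
  have hper : Function.Periodic (fun θ => Real.exp (c * Real.cos θ)) (2 * Real.pi) := fun θ => by
    simp
  have hint : ∀ a b : ℝ, IntervalIntegrable (fun θ => Real.exp (c * Real.cos θ)) volume a b :=
    fun a b => Continuous.intervalIntegrable (by fun_prop) _ _
  have h1 : ∫ θ in (-Real.pi)..Real.pi, Real.exp (c * Real.cos (θ - α)) =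
      ∫ θ in (-Real.pi)..Real.pi, Real.exp (c * Real.cos θ) := by
    rw [intervalIntegral.integral_comp_sub_right (fun θ => Real.exp (c * Real.cos θ)) α]
    have := hper.intervalIntegral_add_eq (-Real.pi - α) (-Real.pi)
    convert this using 2 <;> ring
  have h2 : ∫ θ in (-Real.pi)..0, Real.exp (c * Real.cos θ) =
      ∫ θ in (0 : ℝ)..Real.pi, Real.exp (c * Real.cos θ) := by
    have h := intervalIntegral.integral_comp_neg (a := 0) (b := Real.pi)
      (fun φ => Real.exp (c * Real.cos φ))
    simpa using h.symm
  rw [h1, ← intervalIntegral.integral_add_adjacent_intervals (hint _ 0) (hint 0 _), h2, besselI0]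
  field_simp
  ring

lemma continuous_riceDensity : Continuous fun p : ℝ × ℝ => riceDensity p.1 p.2 := by
  unfold riceDensity
  have := continuous_besselI0
  fun_prop

lemma riceDensity_nonneg {a b : ℝ} (hb : 0 ≤ b) : 0 ≤ riceDensity a b :=
  mul_nonneg (mul_nonneg hb (Real.exp_pos _).le) (besselI0_nonneg _)

lemma riceDensity_neg_left (a b : ℝ) : riceDensity (-a) b = riceDensity a b := by
  simp [riceDensity, besselI0_neg]

lemma riceDensity_neg_right (a b : ℝ) : riceDensity a (-b) = -riceDensity a b := by
  simp [riceDensity, besselI0_neg]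

/-- A Gaussian bound in `a`, uniform for bounded `b`: it follows from `I₀ z ≤ exp |z|` and
`|a| * B ≤ a ^ 2 / 4 + B ^ 2`. -/
lemma abs_riceDensity_le {a b B : ℝ} (hb : |b| ≤ B) :
    |riceDensity a b| ≤ B * Real.exp (B ^ 2) * Real.exp (-(1 / 4) * a ^ 2) := by
  have hB : 0 ≤ B := (abs_nonneg b).trans hb
  rw [riceDensity, abs_mul, abs_mul, Real.abs_exp, abs_of_nonneg (besselI0_nonneg _), mul_assoc,
    mul_assoc]
  refine mul_le_mul hb ?_ (by have := besselI0_nonneg (a * b); positivity) hB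
  calc Real.exp (-(b ^ 2 + a ^ 2) / 2) * besselI0 (a * b)
      ≤ Real.exp (-(b ^ 2 + a ^ 2) / 2) * Real.exp |a * b| :=
        mul_le_mul_of_nonneg_left (besselI0_le_exp_abs _) (Real.exp_pos _).le
    _ = Real.exp (-(b ^ 2 + a ^ 2) / 2 + |a| * |b|) := by rw [← Real.exp_add, abs_mul]
    _ ≤ Real.exp (B ^ 2 + -(1 / 4) * a ^ 2) := by
        refine Real.exp_le_exp.2 ?_
        have h1 : |a| * |b| ≤ |a| * B := mul_le_mul_of_nonneg_left hb (abs_nonneg a)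
        nlinarith [sq_nonneg (|a| / 2 - B), sq_abs a, sq_nonneg b]
    _ = _ := Real.exp_add _ _

/-! ### Polar coordinates in the plane -/

lemma lintegral_plane_polar {f : Plane → ℝ≥0∞} (hf : Measurable f) :
    ∫⁻ w, f w = ∫⁻ s in Ioi (0 : ℝ), ∫⁻ θ in Ioo (-Real.pi) Real.pi,
      ENNReal.ofReal s * f !₂[s * Real.cos θ, s * Real.sin θ] := by
  have hmp := (PiLp.volume_preserving_toLp (Fin 2)).comp
    (volume_preserving_finTwoArrow ℝ).symm
  rw [← hmp.lintegral_comp hf, ← lintegral_comp_polarCoord_symm, polarCoord_target,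
    Measure.volume_eq_prod, setLIntegral_prod]
  · rfl
  · exact ((ENNReal.measurable_ofReal.comp measurable_fst).mul
      ((hf.comp hmp.measurable).comp continuous_polarCoord_symm.measurable)).aemeasurable

lemma norm_sq_plane (w : Plane) : ‖w‖ ^ 2 = w 0 ^ 2 + w 1 ^ 2 := by
  rw [EuclideanSpace.norm_sq_eq, Fin.sum_univ_two]; simp

lemma norm_polar {s : ℝ} (hs : 0 ≤ s) (θ : ℝ) :
    ‖(!₂[s * Real.cos θ, s * Real.sin θ] : Plane)‖ = s := by
  rw [← abs_of_nonneg hs, ← abs_of_nonneg (norm_nonneg _), ← sq_eq_sq_iff_abs_eq_abs,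
    norm_sq_plane]
  simp only [Matrix.cons_val_zero, Matrix.cons_val_one, abs_of_nonneg hs]
  linear_combination s ^ 2 * Real.sin_sq_add_cos_sq θ

lemma exists_polar (x : Plane) :
    ∃ α : ℝ, x 0 = ‖x‖ * Real.cos α ∧ x 1 = ‖x‖ * Real.sin α := by
  have h : ‖(⟨x 0, x 1⟩ : ℂ)‖ = ‖x‖ := by
    rw [← abs_of_nonneg (norm_nonneg x), ← abs_of_nonneg (norm_nonneg (Complex.mk _ _)),
      ← sq_eq_sq_iff_abs_eq_abs, norm_sq_plane, Complex.sq_norm, Complex.normSq_mk]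
    ring
  exact ⟨Complex.arg ⟨x 0, x 1⟩, by rw [← h, Complex.norm_mul_cos_arg],
    by rw [← h, Complex.norm_mul_sin_arg]⟩

lemma continuous_displacementKernel (σ : ℝ) : Continuous (displacementKernel σ) := by
  unfold displacementKernel; fun_prop

/-- The norm of an isotropic Gaussian vector centred at `x` has a Rician law. -/
lemma lintegral_norm_mul_displacementKernel {σ : ℝ} (hσ : 0 < σ) (x : Plane) {g : ℝ → ℝ≥0∞}
    (hg : Measurable g) :
    ∫⁻ w, g ‖w‖ * ENNReal.ofReal (displacementKernel σ (w - x)) =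
      ∫⁻ s in Ioi (0 : ℝ), g s * ENNReal.ofReal (σ⁻¹ * riceDensity (‖x‖ / σ) (s / σ)) := by
  have hk : Measurable fun w => ENNReal.ofReal (displacementKernel σ (w - x)) :=
    ENNReal.measurable_ofReal.comp
      ((continuous_displacementKernel σ).comp (by fun_prop : Continuous (· - x))).measurable
  rw [lintegral_plane_polar
    (f := fun w => g ‖w‖ * ENNReal.ofReal (displacementKernel σ (w - x)))
    ((hg.comp measurable_norm).mul hk)]
  refine setLIntegral_congr_fun measurableSet_Ioi fun s hs => ?_
  have hs : 0 < s := hs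
  obtain ⟨α, h0, h1⟩ := exists_polar x
  set c : ℝ := s * Real.exp (-((s / σ) ^ 2 + (‖x‖ / σ) ^ 2) / 2) / (2 * Real.pi * σ ^ 2)
  have hc : 0 ≤ c := by positivity
  have hpt : ∀ θ, ENNReal.ofReal s * (g ‖(!₂[s * Real.cos θ, s * Real.sin θ] : Plane)‖ *
      ENNReal.ofReal (displacementKernel σ (!₂[s * Real.cos θ, s * Real.sin θ] - x))) =
      g s * ENNReal.ofReal (c * Real.exp ((‖x‖ / σ) * (s / σ) * Real.cos (θ - α))) := fun θ => by
    rw [norm_polar hs.le, mul_left_comm, ← ENNReal.ofReal_mul hs.le]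
    congr 2
    have hn : ‖(!₂[s * Real.cos θ, s * Real.sin θ] - x : Plane)‖ ^ 2 =
        s ^ 2 + ‖x‖ ^ 2 - 2 * (s * ‖x‖ * Real.cos (θ - α)) := by
      rw [norm_sq_plane]
      simp only [PiLp.sub_apply, Matrix.cons_val_zero, Matrix.cons_val_one]
      rw [h0, h1, Real.cos_sub]
      linear_combination s ^ 2 * Real.sin_sq_add_cos_sq θ + ‖x‖ ^ 2 * Real.sin_sq_add_cos_sq α
    have he : Real.exp (-(s ^ 2 + ‖x‖ ^ 2 - 2 * (s * ‖x‖ * Real.cos (θ - α))) / (2 * σ ^ 2)) =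
        Real.exp (-((s / σ) ^ 2 + (‖x‖ / σ) ^ 2) / 2) *
          Real.exp ((‖x‖ / σ) * (s / σ) * Real.cos (θ - α)) := by
      rw [← Real.exp_add]
      congr 1
      field_simp
      ring
    simp only [c]
    rw [displacementKernel, hn, he]
    ring
  calc _ = ∫⁻ θ in Ioo (-Real.pi) Real.pi, g s *
        ENNReal.ofReal (c * Real.exp ((‖x‖ / σ) * (s / σ) * Real.cos (θ - α))) :=
        lintegral_congr fun θ => hpt θ
    _ = _ := by
      rw [lintegral_const_mul _ (by fun_prop), restrict_Ioo_eq_restrict_Ioc,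
        ← ofReal_integral_eq_lintegral_ofReal]
      · rw [← intervalIntegral.integral_of_le (by linarith [Real.pi_pos]),
          intervalIntegral.integral_const_mul, integral_exp_mul_cos_sub]
        congr 2
        simp only [c, riceDensity]
        field_simp
      · exact (Continuous.integrableOn_Icc (by fun_prop)).mono_set Ioc_subset_Icc_self
      · exact ae_of_all _ fun θ => by positivity

lemma integral_displacementKernel {σ : ℝ} (hσ : 0 < σ) :
    ∫ w, displacementKernel σ w = 1 := by
  have h := GaussianFourier.integral_rexp_neg_mul_sq_norm (V := Plane)
    (b := 1 / (2 * σ ^ 2)) (by positivity)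
  simp only [displacementKernel]
  rw [integral_div]
  have h2 : ∀ v : Plane, Real.exp (-‖v‖ ^ 2 / (2 * σ ^ 2)) =
      Real.exp (-(1 / (2 * σ ^ 2)) * ‖v‖ ^ 2) := fun v => by congr 1; field_simp
  simp_rw [h2]
  rw [h]
  simp
  field_simp

lemma displacementKernel_nonneg (σ : ℝ) (w : Plane) : 0 ≤ displacementKernel σ w := by
  unfold displacementKernel; positivity

lemma lintegral_displacementKernel {σ : ℝ} (hσ : 0 < σ) :
    ∫⁻ w, ENNReal.ofReal (displacementKernel σ w) = 1 := by
  have h := integral_displacementKernel hσ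
  have hi : Integrable (displacementKernel σ) := by
    by_contra hn
    rw [integral_undef hn] at h
    exact zero_ne_one h
  rw [← ofReal_integral_eq_lintegral_ofReal hi (ae_of_all _ (displacementKernel_nonneg σ)), h,
    ENNReal.ofReal_one]

/-! ### The Marcum Q-function -/

/-- Total mass one, as the Gaussian vector of which this is the law of the norm has mass one. -/
lemma lintegral_riceDensity (a : ℝ) :
    ∫⁻ t in Ioi (0 : ℝ), ENNReal.ofReal (riceDensity a t) = 1 := by
  have h := lintegral_norm_mul_displacementKernel one_pos (!₂[a, 0] : Plane) (g := fun _ => 1)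
    measurable_const
  have hn : ‖(!₂[a, 0] : Plane)‖ = |a| := by
    rw [← abs_of_nonneg (norm_nonneg _), ← sq_eq_sq_iff_abs_eq_abs, norm_sq_plane]
    simp
  have ha : ∀ t, riceDensity |a| t = riceDensity a t := fun t => by
    rcases abs_choice a with h | h <;> rw [h]
    exact riceDensity_neg_left a t
  simp only [one_mul, inv_one, div_one, hn, ha] at h
  rw [← h, lintegral_sub_right_eq_self (fun w => ENNReal.ofReal (displacementKernel 1 w)),
    lintegral_displacementKernel one_pos]

lemma integrableOn_riceDensity (a : ℝ) : IntegrableOn (riceDensity a) (Ioi 0) := by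
  refine ⟨(continuous_riceDensity.comp (by fun_prop : Continuous fun t : ℝ =>
    (a, t))).aestronglyMeasurable, ?_⟩
  rw [hasFiniteIntegral_iff_ofReal]
  · rw [lintegral_riceDensity]; exact ENNReal.one_lt_top
  · filter_upwards [ae_restrict_mem measurableSet_Ioi] with t ht
    exact riceDensity_nonneg (le_of_lt ht)

lemma integral_riceDensity (a : ℝ) : ∫ t in Ioi (0 : ℝ), riceDensity a t = 1 := by
  rw [integral_eq_lintegral_of_nonneg_ae _ (integrableOn_riceDensity a).1, lintegral_riceDensity]
  · simp
  · filter_upwards [ae_restrict_mem measurableSet_Ioi] with t ht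
    exact riceDensity_nonneg (le_of_lt ht)

/-- The Rician distribution function, extended to an even function of `b`. The oriented integral
makes it differentiable in `b` on the whole line, in particular at `0`. -/
noncomputable def riceCDF (a b : ℝ) : ℝ := ∫ t in (0 : ℝ)..b, riceDensity a t

/-- The total mass of the Rician density is one, so the Marcum Q-function is its tail. -/
lemma one_sub_marcumQ (a b : ℝ) : 1 - marcumQ a b = riceCDF a b := by
  have hb : IntegrableOn (riceDensity a) (Ioi b) := by
    have hu : IntegrableOn (riceDensity a) (Icc b 0 ∪ Ioi 0) :=
      IntegrableOn.union (continuous_riceDensity.comp (by fun_prop : Continuous fun t : ℝ =>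
        (a, t))).integrableOn_Icc (integrableOn_riceDensity a)
    refine hu.mono_set fun t ht => ?_
    rcases le_or_gt t 0 with h | h
    · exact Or.inl ⟨le_of_lt ht, h⟩
    · exact Or.inr h
  have h := intervalIntegral.integral_interval_add_Ioi (integrableOn_riceDensity a) hb
  rw [integral_riceDensity] at h
  rw [riceCDF, sub_eq_iff_eq_add, ← h]
  rfl

lemma riceCDF_nonneg (a b : ℝ) : 0 ≤ riceCDF a b := by
  have hpos : ∀ c : ℝ, 0 ≤ c → 0 ≤ riceCDF a c := fun c hc =>
    intervalIntegral.integral_nonneg hc fun t ht => riceDensity_nonneg ht.1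
  rcases le_total 0 b with h | h
  · exact hpos b h
  · have h2 := intervalIntegral.integral_comp_neg (a := 0) (b := b) (riceDensity a)
    simp only [riceDensity_neg_right, neg_zero] at h2
    rw [intervalIntegral.integral_neg, intervalIntegral.integral_symm 0 (-b), neg_inj] at h2
    exact (hpos (-b) (neg_nonneg.2 h)).trans_eq h2.symm

lemma continuous_riceCDF : Continuous fun p : ℝ × ℝ => riceCDF p.1 p.2 :=
  intervalIntegral.continuous_parametric_primitive_of_continuous continuous_riceDensity

lemma hasDerivAt_riceCDF (a b : ℝ) : HasDerivAt (riceCDF a) (riceDensity a b) b := by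
  have hc : Continuous (riceDensity a) :=
    continuous_riceDensity.comp (by fun_prop : Continuous fun t : ℝ => (a, t))
  exact intervalIntegral.integral_hasDerivAt_right (hc.intervalIntegrable _ _)
    (hc.stronglyMeasurableAtFilter _ _) hc.continuousAt

lemma riceCDF_le {a b B : ℝ} (hb : |b| ≤ B) :
    riceCDF a b ≤ B ^ 2 * Real.exp (B ^ 2) * Real.exp (-(1 / 4) * a ^ 2) := by
  have hB : 0 ≤ B := (abs_nonneg b).trans hb
  have h := intervalIntegral.norm_integral_le_of_norm_le_const (a := 0) (b := b)
    (f := riceDensity a) (C := B * Real.exp (B ^ 2) * Real.exp (-(1 / 4) * a ^ 2)) fun t ht =>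
      abs_riceDensity_le (by
        have := abs_sub_left_of_mem_uIcc (uIoc_subset_uIcc ht)
        simp only [sub_zero] at this
        exact this.trans hb)
  calc riceCDF a b ≤ _ := (le_abs_self _).trans h
    _ ≤ B * Real.exp (B ^ 2) * Real.exp (-(1 / 4) * a ^ 2) * B := by
        gcongr; simpa using hb
    _ = _ := by ring

lemma riceCDF_zero (a : ℝ) : riceCDF a 0 = 0 := intervalIntegral.integral_same

/-! ### The exponent of the Thomas contact distance -/

section Exponent

variable {lamP m σ : ℝ}

lemma thomasExponentIntegrand_eq (lamP m σ r z : ℝ) :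
    thomasExponentIntegrand lamP m σ r z =
      2 * Real.pi * lamP * z * (1 - Real.exp (-m * riceCDF (z / σ) (r / σ))) := by
  rw [thomasExponentIntegrand, one_sub_marcumQ]

lemma thomasPrefactorIntegrand_eq (lamP m σ r z : ℝ) :
    thomasPrefactorIntegrand lamP m σ r z =
      m * lamP * (2 * Real.pi) * (z / σ) * riceDensity (z / σ) (r / σ) *
        Real.exp (-m * riceCDF (z / σ) (r / σ)) := by
  rw [thomasPrefactorIntegrand, one_sub_marcumQ]

lemma continuous_thomasExponentIntegrand (lamP m σ r : ℝ) :
    Continuous (thomasExponentIntegrand lamP m σ r) := by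
  have h : Continuous fun z => riceCDF (z / σ) (r / σ) :=
    continuous_riceCDF.comp (by fun_prop : Continuous fun z : ℝ => (z / σ, r / σ))
  simp only [funext (thomasExponentIntegrand_eq lamP m σ r)]
  fun_prop

lemma continuous_thomasPrefactorIntegrand (lamP m σ r : ℝ) :
    Continuous (thomasPrefactorIntegrand lamP m σ r) := by
  have h : Continuous fun z => riceCDF (z / σ) (r / σ) :=
    continuous_riceCDF.comp (by fun_prop : Continuous fun z : ℝ => (z / σ, r / σ))
  have h2 : Continuous fun z => riceDensity (z / σ) (r / σ) :=
    continuous_riceDensity.comp (by fun_prop : Continuous fun z : ℝ => (z / σ, r / σ))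
  simp only [funext (thomasPrefactorIntegrand_eq lamP m σ r)]
  fun_prop

lemma one_sub_exp_riceCDF_nonneg (hm : 0 < m) (a b : ℝ) :
    0 ≤ 1 - Real.exp (-m * riceCDF a b) :=
  sub_nonneg.2 (Real.exp_le_one_iff.2 (by nlinarith [riceCDF_nonneg a b]))

lemma thomasExponentIntegrand_nonneg (hlamP : 0 < lamP) (hm : 0 < m) (r : ℝ) {z : ℝ}
    (hz : 0 < z) : 0 ≤ thomasExponentIntegrand lamP m σ r z := by
  rw [thomasExponentIntegrand_eq]
  exact mul_nonneg (by positivity) (one_sub_exp_riceCDF_nonneg hm _ _)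

lemma thomasPrefactorIntegrand_nonneg (hlamP : 0 < lamP) (hm : 0 < m) (hσ : 0 < σ) {r z : ℝ}
    (hr : 0 < r) (hz : 0 < z) : 0 ≤ thomasPrefactorIntegrand lamP m σ r z := by
  rw [thomasPrefactorIntegrand_eq]
  have := riceDensity_nonneg (a := z / σ) (div_pos hr hσ).le
  positivity

lemma integrable_mul_gaussian (hσ : 0 < σ) (C : ℝ) :
    Integrable fun z : ℝ => C * (z * Real.exp (-(1 / 4) * (z / σ) ^ 2)) := by
  have h := (integrable_mul_exp_neg_mul_sq (b := 1 / (4 * σ ^ 2)) (by positivity)).const_mul C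
  refine h.congr (ae_of_all _ fun z => ?_)
  simp only
  congr 3
  field_simp

lemma integrableOn_thomasExponentIntegrand (hlamP : 0 < lamP) (hm : 0 < m) (hσ : 0 < σ) (r : ℝ) :
    IntegrableOn (thomasExponentIntegrand lamP m σ r) (Ioi 0) := by
  set B := |r / σ|
  refine Integrable.mono' (integrable_mul_gaussian hσ
    (2 * Real.pi * lamP * m * (B ^ 2 * Real.exp (B ^ 2)))).integrableOn
    (continuous_thomasExponentIntegrand lamP m σ r).aestronglyMeasurable ?_
  filter_upwards [ae_restrict_mem measurableSet_Ioi] with z hz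
  have hz : 0 < z := hz
  have h1 := riceCDF_le (a := z / σ) (le_refl |r / σ|)
  have h2 : 1 - Real.exp (-m * riceCDF (z / σ) (r / σ)) ≤ m * riceCDF (z / σ) (r / σ) := by
    linarith [Real.add_one_le_exp (-m * riceCDF (z / σ) (r / σ))]
  rw [Real.norm_of_nonneg (thomasExponentIntegrand_nonneg hlamP hm r hz),
    thomasExponentIntegrand_eq]
  calc _ ≤ 2 * Real.pi * lamP * z * (m * (B ^ 2 * Real.exp (B ^ 2) *
        Real.exp (-(1 / 4) * (z / σ) ^ 2))) := by gcongr; exact h2.trans (by gcongr)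
    _ = _ := by ring

lemma hasDerivAt_thomasExponentIntegrand (lamP m r z : ℝ) :
    HasDerivAt (fun r => thomasExponentIntegrand lamP m σ r z)
      (thomasPrefactorIntegrand lamP m σ r z) r := by
  simp only [thomasExponentIntegrand_eq, thomasPrefactorIntegrand_eq]
  have h1 : HasDerivAt (fun r => riceCDF (z / σ) (r / σ))
      (riceDensity (z / σ) (r / σ) * (1 / σ)) r :=
    HasDerivAt.comp (h := fun r => r / σ) r (hasDerivAt_riceCDF (z / σ) (r / σ))
      ((hasDerivAt_id r).div_const σ)
  have h2 := (((h1.const_mul (-m)).exp).const_sub 1).const_mul (2 * Real.pi * lamP * z)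
  exact h2.congr_deriv (by ring)

/-- Differentiation of the exponent under the integral sign; in particular, the integrand of the
prefactor is integrable. -/
lemma hasDerivAt_integral_thomasExponentIntegrand (hlamP : 0 < lamP) (hm : 0 < m) (hσ : 0 < σ)
    (r : ℝ) :
    IntegrableOn (thomasPrefactorIntegrand lamP m σ r) (Ioi 0) ∧
    HasDerivAt (fun r => ∫ z in Ioi 0, thomasExponentIntegrand lamP m σ r z)
      (∫ z in Ioi 0, thomasPrefactorIntegrand lamP m σ r z) r := by
  set B := |r / σ| + 1 / σ
  have hB : ∀ r' ∈ Metric.ball r 1, |r' / σ| ≤ B := fun r' hr' => by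
    have h1 : |r' - r| < 1 := hr'
    have h2 : r' / σ = r / σ + (r' - r) / σ := by ring
    have h3 : |(r' - r) / σ| ≤ 1 / σ := by rw [abs_div, abs_of_pos hσ]; gcongr
    rw [h2]
    exact (abs_add_le _ _).trans (by simp only [B]; linarith)
  refine hasDerivAt_integral_of_dominated_loc_of_deriv_le
    (bound := fun z => 2 * Real.pi * lamP * m / σ * (B * Real.exp (B ^ 2)) *
      (z * Real.exp (-(1 / 4) * (z / σ) ^ 2)))
    (Metric.ball_mem_nhds r one_pos)
    (Eventually.of_forall fun r' =>
      (continuous_thomasExponentIntegrand lamP m σ r').aestronglyMeasurable)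
    (integrableOn_thomasExponentIntegrand hlamP hm hσ r)
    (continuous_thomasPrefactorIntegrand lamP m σ r).aestronglyMeasurable ?_
    (integrable_mul_gaussian hσ _).integrableOn
    (ae_of_all _ fun z r' _ => hasDerivAt_thomasExponentIntegrand lamP m r' z)
  filter_upwards [ae_restrict_mem measurableSet_Ioi] with z hz r' hr'
  have hz : 0 < z := hz
  have h1 := abs_riceDensity_le (a := z / σ) (hB r' hr')
  have h2 : Real.exp (-m * riceCDF (z / σ) (r' / σ)) ≤ 1 :=
    Real.exp_le_one_iff.2 (by nlinarith [riceCDF_nonneg (z / σ) (r' / σ)])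
  rw [thomasPrefactorIntegrand_eq, norm_mul, norm_mul, Real.norm_eq_abs (riceDensity _ _),
    Real.norm_of_nonneg (Real.exp_pos _).le, Real.norm_of_nonneg (by positivity)]
  calc _ ≤ m * lamP * (2 * Real.pi) * (z / σ) *
        (B * Real.exp (B ^ 2) * Real.exp (-(1 / 4) * (z / σ) ^ 2)) * 1 := by gcongr
    _ = _ := by ring

end Exponent

/-! ### The void probability of a Thomas process -/

lemma count_eq_zero_iff (φ : Configuration) (A : Set Plane) :
    φ.count A = 0 ↔ ∀ y ∈ φ.points, y ∉ A := by
  rw [Configuration.count, encard_eq_zero, eq_empty_iff_forall_notMem]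
  simp [mem_inter_iff]

/-- Emptiness of a ball is jointly measurable in its centre and the configuration: the ball
contains a point if and only if some ball from a countable family inside it does. -/
lemma measurableSet_count_ball_eq_zero (r : ℝ) :
    MeasurableSet {p : Plane × Configuration | p.2.count (Metric.ball p.1 r) = 0} := by
  rw [← MeasurableSet.compl_iff]
  have h : {p : Plane × Configuration | p.2.count (Metric.ball p.1 r) = 0}ᶜ =
      ⋃ (n : ℕ) (s : ℚ), {x : Plane | dist (TopologicalSpace.denseSeq Plane n) x + s ≤ r} ×ˢ
        {φ : Configuration | φ.count (Metric.ball (TopologicalSpace.denseSeq Plane n) s) = 0}ᶜ := by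
    ext ⟨x, φ⟩
    simp only [mem_compl_iff, mem_ofPred_eq, mem_iUnion, mem_prod, count_eq_zero_iff,
      Metric.mem_ball, not_forall, not_not, exists_prop]
    constructor
    · rintro ⟨y, hy, hyx⟩
      obtain ⟨_, hn, ⟨n, rfl⟩⟩ := Metric.dense_iff.1 (TopologicalSpace.denseRange_denseSeq Plane) y
        ((r - dist y x) / 3) (by linarith)
      obtain ⟨s, hs1, hs2⟩ := exists_rat_btwn
        (show (r - dist y x) / 3 < (r - dist y x) / 2 by linarith)
      rw [Metric.mem_ball] at hn
      refine ⟨n, s, ?_, y, hy, ?_⟩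
      · have := dist_triangle (TopologicalSpace.denseSeq Plane n) y x
        linarith
      · rw [dist_comm]; linarith
    · rintro ⟨n, s, h1, y, hy, h2⟩
      have := dist_triangle y (TopologicalSpace.denseSeq Plane n) x
      exact ⟨y, hy, by linarith⟩
  rw [h]
  refine MeasurableSet.iUnion fun n => MeasurableSet.iUnion fun s => MeasurableSet.prod ?_ ?_
  · exact measurableSet_le (by fun_prop) measurable_const
  · exact (measurable_count Metric.isOpen_ball.measurableSet (measurableSet_singleton 0)).compl

/-- The intensity measure of a cluster of a Thomas process around its parent. -/
noncomputable def clusterIntensity (m σ : ℝ) : Measure Plane :=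
  volume.withDensity fun y => ENNReal.ofReal (m * displacementKernel σ y)

lemma clusterIntensity_ball_ne_top (m σ : ℝ) (x : Plane) (r : ℝ) :
    clusterIntensity m σ (Metric.ball x r) ≠ ∞ := by
  have : IsLocallyFiniteMeasure (clusterIntensity m σ) :=
    IsLocallyFiniteMeasure.withDensity_ofReal
      ((continuous_const.mul (continuous_displacementKernel σ)))
  exact measure_ball_lt_top.ne

lemma measurable_clusterIntensity_ball (m σ r : ℝ) :
    Measurable fun x => clusterIntensity m σ (Metric.ball (-x) r) := by
  have : SFinite (clusterIntensity m σ) := by unfold clusterIntensity; infer_instance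
  have hs : MeasurableSet {p : Plane × Plane | dist p.2 (-p.1) < r} :=
    measurableSet_lt (by fun_prop) measurable_const
  exact measurable_measure_prodMk_left hs

/-- The probability that every process in an independent family of Poisson processes leaves its
own set empty. -/
lemma measure_forall_count_eq_zero {Λ : Measure Plane} {Ψ : ℕ → Ω → Configuration}
    (hΨ : ∀ i, IsPoissonProcess (Ψ i) Λ μ) (hind : iIndepFun Ψ μ) {A : ℕ → Set Plane}
    (hA : ∀ i, MeasurableSet (A i)) (hΛ : ∀ i, Λ (A i) ≠ ∞) :
    μ {ω | ∀ i, (Ψ i ω).count (A i) = 0} = negExp (∑' i, Λ (A i)) := by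
  have := hind.isProbabilityMeasure
  have hm : ∀ i, MeasurableSet {φ : Configuration | φ.count (A i) = 0} := fun i =>
    measurable_count (hA i) (measurableSet_singleton 0)
  let E : ℕ → Set Ω := fun n => ⋂ i ∈ Finset.range n, Ψ i ⁻¹' {φ | φ.count (A i) = 0}
  have hE : ∀ n, μ (E n) = negExp (∑ i ∈ Finset.range n, Λ (A i)) := fun n => by
    rw [hind.measure_inter_preimage_eq_mul (Finset.range n) fun i _ => hm i, negExp_sum]
    exact Finset.prod_congr rfl fun i _ => (hΨ i).measure_count_eq_zero (hA i) (hΛ i)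
  have hEm : ∀ n, MeasurableSet (E n) := fun n =>
    Finset.measurableSet_biInter _ fun i _ => (hΨ i).measurable (hm i)
  have hanti : Antitone E := fun n k hnk =>
    biInter_subset_biInter_left fun i hi => Finset.mem_coe.2 (Finset.range_mono hnk hi)
  have hInter : ⋂ n, E n = {ω | ∀ i, (Ψ i ω).count (A i) = 0} := by
    ext ω
    simp only [E, mem_iInter, Finset.mem_range, mem_preimage, mem_ofPred_eq]
    exact ⟨fun h i => h (i + 1) i (Nat.lt_succ_self i), fun h n i _ => h i⟩
  have h1 := tendsto_measure_iInter_atTop (μ := μ) (fun n => (hEm n).nullMeasurableSet) hanti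
    ⟨0, measure_ne_top _ _⟩
  rw [hInter] at h1
  refine tendsto_nhds_unique h1 ?_
  simp only [Function.comp_def, hE]
  exact (continuous_negExp.tendsto _).comp ENNReal.summable.hasSum.tendsto_sum_nat

/-- The probability that a Thomas process has no point in a ball around the origin: given the
parents, the clusters are independent Poisson processes, and averaging over the parents evaluates
the Laplace functional of the parent process. -/
theorem IsThomasProcess.measure_count_ball_eq_zero [IsProbabilityMeasure μ]
    {Φ : Ω → Configuration} {lamP m σ : ℝ} (h : IsThomasProcess Φ lamP m σ μ) (r : ℝ) :
    μ {ω | (Φ ω).count (Metric.ball 0 r) = 0} =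
      negExp (ENNReal.ofReal lamP *
        ∫⁻ x, (1 - negExp (clusterIntensity m σ (Metric.ball (-x) r)))) := by
  obtain ⟨-, Φp, X, Ψ, hp, hXm, hX, hΨ, hind, hXΨ, hΦ⟩ := h
  change ∀ i, IsPoissonProcess (Ψ i) (clusterIntensity m σ) μ at hΨ
  let S : Set ((ℕ → Plane) × (ℕ → Configuration)) :=
    {p | ∀ i, (p.2 i).count (Metric.ball (-p.1 i) r) = 0}
  have hS : MeasurableSet S := by
    have : S = ⋂ i, (fun p : (ℕ → Plane) × (ℕ → Configuration) => (-p.1 i, p.2 i)) ⁻¹'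
        {p : Plane × Configuration | p.2.count (Metric.ball p.1 r) = 0} := by
      ext p; simp [S]
    rw [this]
    exact MeasurableSet.iInter fun i =>
      (by fun_prop : Measurable fun p : (ℕ → Plane) × (ℕ → Configuration) => (-p.1 i, p.2 i))
        (measurableSet_count_ball_eq_zero r)
  have hXm' : Measurable fun ω i => X i ω := measurable_pi_lambda _ hXm
  have hΨm : Measurable fun ω i => Ψ i ω := measurable_pi_lambda _ fun i => (hΨ i).measurable
  have h1 : μ {ω | (Φ ω).count (Metric.ball 0 r) = 0} =
      μ ((fun ω => ((fun i => X i ω), (fun i => Ψ i ω))) ⁻¹' S) := by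
    refine measure_congr ?_
    filter_upwards [hΦ] with ω hω
    refine propext ?_
    change (Φ ω).count (Metric.ball 0 r) = 0 ↔
      ∀ i, (Ψ i ω).count (Metric.ball (-X i ω) r) = 0
    simp only [count_eq_zero_iff, hω, mem_iUnion, mem_image, Metric.mem_ball, dist_eq_norm,
      sub_zero, sub_neg_eq_add]
    constructor
    · intro h i y hy
      rw [add_comm]
      exact h _ ⟨i, y, hy, rfl⟩
    · rintro h _ ⟨i, y, hy, rfl⟩
      rw [add_comm]
      exact h i y hy
  have hmap := (indepFun_iff_map_prod_eq_prod_map_map hXm'.aemeasurable hΨm.aemeasurable).1 hXΨ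
  have : IsProbabilityMeasure (μ.map fun ω i => Ψ i ω) :=
    Measure.isProbabilityMeasure_map hΨm.aemeasurable
  rw [h1, ← Measure.map_apply (hXm'.prodMk hΨm) hS, hmap, Measure.prod_apply hS,
    lintegral_map (measurable_measure_prodMk_left hS) hXm']
  have h2 : ∀ ω, (μ.map fun ω i => Ψ i ω) (Prod.mk (fun i => X i ω) ⁻¹' S) =
      negExp (∑' i, clusterIntensity m σ (Metric.ball (-X i ω) r)) := fun ω => by
    rw [Measure.map_apply hΨm (measurable_prodMk_left hS)]
    exact measure_forall_count_eq_zero (A := fun i => Metric.ball (-X i ω) r) hΨ hind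
      (fun i => Metric.isOpen_ball.measurableSet)
      fun i => clusterIntensity_ball_ne_top m σ (-X i ω) r
  simp_rw [h2]
  have : SigmaFinite (ENNReal.ofReal lamP • volume : Measure Plane) :=
    inferInstanceAs (SigmaFinite (lamP.toNNReal • volume : Measure Plane))
  have h3 := IsPoissonProcess.lintegral_negExp_tsum (Λ := ENNReal.ofReal lamP • volume) hp hXm hX
    (measurable_clusterIntensity_ball m σ r)
  rw [lintegral_smul_measure, smul_eq_mul] at h3
  exact h3

/-- A cluster around `x` has `m` times the Rician probability as its mean number of points in a
ball around the origin. -/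
lemma clusterIntensity_ball {m σ : ℝ} (hm : 0 ≤ m) (hσ : 0 < σ) (x : Plane) {r : ℝ} (hr : 0 ≤ r) :
    clusterIntensity m σ (Metric.ball (-x) r) =
      ENNReal.ofReal (m * riceCDF (‖x‖ / σ) (r / σ)) := by
  have h1 : clusterIntensity m σ (Metric.ball (-x) r) =
      ENNReal.ofReal m * ∫⁻ y, (Iio r).indicator 1 ‖y + x‖ *
        ENNReal.ofReal (displacementKernel σ y) := by
    rw [clusterIntensity, withDensity_apply _ Metric.isOpen_ball.measurableSet,
      ← lintegral_indicator Metric.isOpen_ball.measurableSet, ← lintegral_const_mul']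
    · refine lintegral_congr fun y => ?_
      by_cases hy : ‖y + x‖ < r
      · rw [indicator_of_mem (by simpa [dist_eq_norm] using hy), ENNReal.ofReal_mul hm,
          indicator_of_mem (by simpa using hy)]
        simp
      · rw [indicator_of_notMem (by simpa [dist_eq_norm] using hy),
          indicator_of_notMem (by simpa using hy)]
        simp
    · exact ENNReal.ofReal_ne_top
  have h2 := lintegral_add_right_eq_self (μ := (volume : Measure Plane))
    (fun w => (Iio r).indicator (1 : ℝ → ℝ≥0∞) ‖w‖ *
      ENNReal.ofReal (displacementKernel σ (w - x))) x
  simp only [add_sub_cancel_right] at h2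
  rw [h1, h2, lintegral_norm_mul_displacementKernel hσ x
    (measurable_one.indicator measurableSet_Iio), ENNReal.ofReal_mul hm]
  congr 1
  have h3 : ∀ s, (Iio r).indicator (1 : ℝ → ℝ≥0∞) s *
      ENNReal.ofReal (σ⁻¹ * riceDensity (‖x‖ / σ) (s / σ)) = (Iio r).indicator
        (fun s => ENNReal.ofReal (σ⁻¹ * riceDensity (‖x‖ / σ) (s / σ))) s := fun s => by
    by_cases hs : s ∈ Iio r <;> simp [hs]
  have hc : Continuous fun s => σ⁻¹ * riceDensity (‖x‖ / σ) (s / σ) :=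
    continuous_const.mul (continuous_riceDensity.comp
      (by fun_prop : Continuous fun s : ℝ => (‖x‖ / σ, s / σ)))
  simp_rw [h3]
  rw [lintegral_indicator measurableSet_Iio, Measure.restrict_restrict measurableSet_Iio,
    inter_comm, Ioi_inter_Iio, restrict_Ioo_eq_restrict_Ioc, ← ofReal_integral_eq_lintegral_ofReal]
  · rw [← intervalIntegral.integral_of_le hr, intervalIntegral.integral_const_mul, riceCDF,
      intervalIntegral.integral_comp_div _ hσ.ne', zero_div, smul_eq_mul,
      inv_mul_cancel_left₀ hσ.ne']
  · exact hc.integrableOn_Icc.mono_set Ioc_subset_Icc_self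
  · filter_upwards [ae_restrict_mem measurableSet_Ioc] with s hs
    exact mul_nonneg (by positivity) (riceDensity_nonneg (div_nonneg hs.1.le hσ.le))

lemma lintegral_fun_norm_plane {f : ℝ → ℝ≥0∞} (hf : Measurable f) :
    ∫⁻ x : Plane, f ‖x‖ = ∫⁻ z in Ioi (0 : ℝ), ENNReal.ofReal (2 * Real.pi * z) * f z := by
  rw [lintegral_plane_polar (f := fun x => f ‖x‖) (hf.comp measurable_norm)]
  refine setLIntegral_congr_fun measurableSet_Ioi fun z hz => ?_
  have hz : 0 < z := hz
  simp only [norm_polar hz.le, lintegral_const, Measure.restrict_apply_univ, Real.volume_Ioo]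
  rw [mul_right_comm, ← ENNReal.ofReal_mul hz.le]
  congr 2
  ring

/-- The mean number of points of the parent process whose cluster hits the ball of radius `r`. -/
lemma lintegral_one_sub_negExp_clusterIntensity {lamP m σ : ℝ} (hlamP : 0 < lamP) (hm : 0 < m)
    (hσ : 0 < σ) {r : ℝ} (hr : 0 ≤ r) :
    ENNReal.ofReal lamP * ∫⁻ x, (1 - negExp (clusterIntensity m σ (Metric.ball (-x) r))) =
      ENNReal.ofReal (∫ z in Ioi 0, thomasExponentIntegrand lamP m σ r z) := by
  let f : ℝ → ℝ := fun z => 1 - Real.exp (-m * riceCDF (z / σ) (r / σ))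
  have hfc : Continuous f := by
    have h : Continuous fun z => riceCDF (z / σ) (r / σ) :=
      continuous_riceCDF.comp (by fun_prop : Continuous fun z : ℝ => (z / σ, r / σ))
    fun_prop
  have h1 : ∀ x : Plane, 1 - negExp (clusterIntensity m σ (Metric.ball (-x) r)) =
      ENNReal.ofReal (f ‖x‖) := fun x => by
    rw [clusterIntensity_ball hm.le hσ x hr,
      negExp_ofReal (mul_nonneg hm.le (riceCDF_nonneg _ _)),
      ENNReal.ofReal_sub _ (Real.exp_pos _).le, ENNReal.ofReal_one, neg_mul]
  simp_rw [h1]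
  rw [lintegral_fun_norm_plane (f := fun z => ENNReal.ofReal (f z)) (by fun_prop),
    ← lintegral_const_mul' _ _ ENNReal.ofReal_ne_top,
    ofReal_integral_eq_lintegral_ofReal (integrableOn_thomasExponentIntegrand hlamP hm hσ r)]
  · refine setLIntegral_congr_fun measurableSet_Ioi fun z hz => ?_
    have hz : 0 < z := hz
    rw [← ENNReal.ofReal_mul (by positivity), ← ENNReal.ofReal_mul (by positivity),
      thomasExponentIntegrand_eq]
    congr 1
    simp only [f]
    ring
  · filter_upwards [ae_restrict_mem measurableSet_Ioi] with z hz
    exact thomasExponentIntegrand_nonneg hlamP hm r hz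

/-- The exponent is unbounded: for parents at distance at most `r - 1`, the probability of a
daughter point in the ball of radius `r` is bounded below. -/
lemma tendsto_integral_thomasExponentIntegrand {lamP m σ : ℝ} (hlamP : 0 < lamP) (hm : 0 < m)
    (hσ : 0 < σ) :
    Tendsto (fun r => ∫ z in Ioi 0, thomasExponentIntegrand lamP m σ r z) atTop atTop := by
  set p := 1 - negExp (clusterIntensity m σ (Metric.ball 0 1)) with hp
  have hp_top : p ≠ ∞ := ne_top_of_le_ne_top ENNReal.one_ne_top tsub_le_self
  have hp_pos : 0 < p := by
    have hc : clusterIntensity m σ (Metric.ball 0 1) ≠ 0 := by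
      have hpos : ∀ y, ENNReal.ofReal (m * displacementKernel σ y) ≠ 0 := fun y => by
        rw [Ne, ENNReal.ofReal_eq_zero, not_le]
        unfold displacementKernel
        positivity
      have hmeas : Measurable fun y => ENNReal.ofReal (m * displacementKernel σ y) :=
        ENNReal.measurable_ofReal.comp
          (continuous_const.mul (continuous_displacementKernel σ)).measurable
      rw [clusterIntensity, Ne, withDensity_apply_eq_zero hmeas]
      simp only [hpos, ne_eq, not_false_eq_true, ofPred_true, univ_inter]
      exact (Metric.measure_ball_pos volume 0 one_pos).ne'
    have hc2 := clusterIntensity_ball_ne_top m σ 0 1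
    rw [hp, tsub_pos_iff_lt, negExp_eq_ofReal hc2, ENNReal.ofReal_lt_one, Real.exp_lt_one_iff]
    exact neg_neg_of_pos (ENNReal.toReal_pos hc hc2)
  have hbound : ∀ r : ℝ, 1 ≤ r → lamP * p.toReal * Real.pi * (r - 1) ^ 2 ≤
      ∫ z in Ioi 0, thomasExponentIntegrand lamP m σ r z := fun r hr => by
    have hnn : 0 ≤ ∫ z in Ioi 0, thomasExponentIntegrand lamP m σ r z :=
      setIntegral_nonneg measurableSet_Ioi fun z hz =>
        thomasExponentIntegrand_nonneg hlamP hm r hz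
    rw [← ENNReal.ofReal_le_ofReal_iff hnn,
      ← lintegral_one_sub_negExp_clusterIntensity hlamP hm hσ (by linarith)]
    calc ENNReal.ofReal (lamP * p.toReal * Real.pi * (r - 1) ^ 2)
        = ENNReal.ofReal lamP * (p * volume (Metric.ball (0 : Plane) (r - 1))) := by
          rw [EuclideanSpace.volume_ball_fin_two, ← ENNReal.ofReal_pow (by linarith),
            ← ENNReal.ofReal_toReal hp_top, ← NNReal.coe_real_pi,
            ENNReal.ofReal_mul (by positivity),
            ENNReal.ofReal_mul (by positivity), ENNReal.ofReal_mul (by positivity)]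
          simp only [ENNReal.toReal_ofReal ENNReal.toReal_nonneg, ENNReal.ofReal_coe_nnreal]
          ring
      _ ≤ _ := by
          gcongr
          rw [← setLIntegral_const]
          refine (setLIntegral_mono' Metric.isOpen_ball.measurableSet fun x hx => ?_).trans
            (setLIntegral_le_lintegral _ _)
          refine tsub_le_tsub_left (antitone_negExp (measure_mono fun y hy => ?_)) 1
          simp only [Metric.mem_ball, dist_eq_norm, sub_zero, sub_neg_eq_add] at hx hy ⊢
          linarith [norm_add_le y x]
  have hK : 0 < lamP * p.toReal * Real.pi := by
    have := ENNReal.toReal_pos hp_pos.ne' hp_top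
    positivity
  refine tendsto_atTop_mono' atTop ((eventually_ge_atTop 1).mono hbound) ?_
  exact ((tendsto_pow_atTop two_ne_zero).comp
    (tendsto_atTop_add_const_right atTop (-1) tendsto_id)).const_mul_atTop hK

/-! ### The law of the contact distance -/

/-- For an empty configuration, the infimum distance is the junk value `0`. -/
lemma le_contactDistance_iff {φ : Configuration} {r : ℝ} (hr : 0 < r) :
    r ≤ φ.contactDistance ↔ φ.count (Metric.ball 0 r) = 0 ∧ φ.count univ ≠ 0 := by
  simp only [count_eq_zero_iff, ne_eq, mem_univ, not_true_eq_false, imp_false, Metric.mem_ball,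
    not_lt, Configuration.contactDistance]
  rcases φ.points.eq_empty_or_nonempty with h | h
  · simp [h, hr]
  · rw [Metric.le_infDist h]
    simp only [dist_comm (0 : Plane)]
    exact ⟨fun h' => ⟨fun y hy => h' hy, fun h'' => h'' _ h.some_mem⟩, fun h' y hy => h'.1 y hy⟩

lemma measurable_contactDistance : Measurable Configuration.contactDistance := by
  refine measurable_of_Ici fun r => ?_
  rcases le_or_gt r 0 with hr | hr
  · rw [eq_univ_of_forall (s := Configuration.contactDistance ⁻¹' Ici r)
      fun φ => hr.trans Metric.infDist_nonneg]
    exact MeasurableSet.univ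
  · have : Configuration.contactDistance ⁻¹' Ici r =
        (fun φ : Configuration => φ.count (Metric.ball 0 r)) ⁻¹' {0} ∩
          (fun φ : Configuration => φ.count univ) ⁻¹' {0}ᶜ := by
      ext φ
      exact le_contactDistance_iff hr
    rw [this]
    exact (measurable_count Metric.isOpen_ball.measurableSet (measurableSet_singleton 0)).inter
      (measurable_count MeasurableSet.univ (measurableSet_singleton 0).compl)

/-- A random variable with a differentiable survival function `S` on `[0, ∞)` has the density
`-S'`. -/
lemma map_eq_withDensity_of_survival [IsProbabilityMeasure μ] {T : Ω → ℝ} (hT : Measurable T)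
    {S f : ℝ → ℝ} (hS : ∀ r, 0 ≤ r → HasDerivAt S (-f r) r) (hf : ∀ r, 0 < r → 0 ≤ f r)
    (hS0 : S 0 = 1) (hlim : Tendsto S atTop (𝓝 0))
    (hlaw : ∀ r, 0 < r → μ {ω | r ≤ T ω} = ENNReal.ofReal (S r)) :
    IntegrableOn f (Ioi 0) ∧
      μ.map T = (volume.restrict (Ioi 0)).withDensity fun r => ENNReal.ofReal (f r) := by
  have hint : ∀ a, 0 ≤ a → IntegrableOn f (Ioi a) ∧ ∫ r in Ioi a, f r = S a := fun a ha => by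
    have h1 : ∀ x ∈ Ici a, HasDerivAt S (-f x) x := fun x hx => hS x (ha.trans hx)
    have h2 : ∀ x ∈ Ioi a, -f x ≤ 0 := fun x hx =>
      neg_nonpos.2 (hf x (lt_of_le_of_lt ha hx))
    have h3 := integral_Ioi_of_hasDerivAt_of_nonpos' h1 h2 hlim
    rw [integral_neg, zero_sub, neg_inj] at h3
    exact ⟨integrable_neg_iff.1 (integrableOn_Ioi_deriv_of_nonpos' h1 h2 hlim), h3⟩
  have hlint : ∀ a, 0 ≤ a → ∫⁻ r in Ioi a, ENNReal.ofReal (f r) = ENNReal.ofReal (S a) :=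
    fun a ha => by
      rw [← (hint a ha).2, ofReal_integral_eq_lintegral_ofReal (hint a ha).1]
      filter_upwards [ae_restrict_mem measurableSet_Ioi] with r hr using hf r (lt_of_le_of_lt ha hr)
  refine ⟨(hint 0 le_rfl).1, ?_⟩
  have : IsProbabilityMeasure (μ.map T) := Measure.isProbabilityMeasure_map hT.aemeasurable
  refine Measure.ext_of_Ici _ _ fun a => ?_
  rw [withDensity_apply _ measurableSet_Ici, Measure.restrict_restrict measurableSet_Ici,
    Measure.map_apply hT measurableSet_Ici]
  rcases le_or_gt a 0 with ha | ha
  · rw [inter_eq_right.2 (show Ioi 0 ⊆ Ici a from fun x hx => ha.trans (le_of_lt hx)),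
      hlint 0 le_rfl, hS0, ENNReal.ofReal_one]
    refine le_antisymm prob_le_one ?_
    have hcont : Tendsto (fun r => ENNReal.ofReal (S r)) (𝓝[>] 0) (𝓝 (ENNReal.ofReal (S 0))) :=
      (ENNReal.continuous_ofReal.tendsto _).comp
        ((hS 0 le_rfl).continuousAt.tendsto.mono_left nhdsWithin_le_nhds)
    rw [hS0, ENNReal.ofReal_one] at hcont
    refine le_of_tendsto hcont ?_
    filter_upwards [self_mem_nhdsWithin] with r hr
    rw [← hlaw r hr]
    exact measure_mono fun ω hω => (ha.trans (le_of_lt hr)).trans hω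
  · rw [inter_eq_left.2 (show Ici a ⊆ Ioi 0 from fun x hx => lt_of_lt_of_le ha hx),
      setLIntegral_congr Ioi_ae_eq_Ici.symm, hlint a ha.le]
    exact hlaw a ha

/-- If the void probability of the ball of radius `r` around the origin is `exp (-E r)`, then the
contact distance has the density `E' * exp (-E)`. -/
lemma map_contactDistance [IsProbabilityMeasure μ] {Φ : Ω → Configuration} (hΦ : Measurable Φ)
    {E p : ℝ → ℝ} (hE0 : E 0 = 0) (hE : ∀ r, 0 ≤ r → HasDerivAt E (p r) r)
    (hp : ∀ r, 0 < r → 0 ≤ p r) (hEtop : Tendsto E atTop atTop)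
    (hvoid : ∀ r, 0 < r →
      μ {ω | (Φ ω).count (Metric.ball 0 r) = 0} = ENNReal.ofReal (Real.exp (-E r))) :
    IntegrableOn (fun r => p r * Real.exp (-E r)) (Ioi 0) ∧
      μ.map (fun ω => (Φ ω).contactDistance) = (volume.restrict (Ioi 0)).withDensity
        fun r => ENNReal.ofReal (p r * Real.exp (-E r)) := by
  have hlim : Tendsto (fun r => Real.exp (-E r)) atTop (𝓝 0) :=
    Real.tendsto_exp_neg_atTop_nhds_zero.comp hEtop
  -- The void probabilities tend to zero, so that the junk value for an empty configuration is
  -- taken with probability zero only.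
  have hempty : μ {ω | (Φ ω).count univ = 0} = 0 := by
    have h1 := (ENNReal.continuous_ofReal.tendsto 0).comp hlim
    rw [ENNReal.ofReal_zero] at h1
    refine le_antisymm (ge_of_tendsto h1 ?_) zero_le
    filter_upwards [eventually_gt_atTop 0] with r hr
    rw [Function.comp_apply, ← hvoid r hr]
    refine measure_mono fun ω hω => ?_
    exact (count_eq_zero_iff _ _).2 fun y hy _ => (count_eq_zero_iff _ _).1 hω y hy (mem_univ y)
  refine map_eq_withDensity_of_survival (measurable_contactDistance.comp hΦ)
    (fun r hr => ?_) (fun r hr => mul_nonneg (hp r hr) (Real.exp_pos _).le) (by simp [hE0]) hlim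
    fun r hr => ?_
  · exact (hE r hr).neg.exp.congr_deriv (by simp only [Pi.neg_apply]; ring)
  · rw [← hvoid r hr]
    refine measure_congr ?_
    have hne : ∀ᵐ ω ∂μ, (Φ ω).count univ ≠ 0 := ae_iff.2 (by simpa using hempty)
    filter_upwards [hne] with ω hω
    refine propext ?_
    change r ≤ (Φ ω).contactDistance ↔ (Φ ω).count (Metric.ball 0 r) = 0
    rw [le_contactDistance_iff hr]
    exact and_iff_left hω

lemma map_contactDistance_poisson [IsProbabilityMeasure μ] {Φ : Ω → Configuration} {lam : ℝ}
    (hlam : 0 < lam) (h : IsHomogeneousPoisson Φ lam μ) :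
    IntegrableOn (poissonContactDensity lam) (Ioi 0) ∧
      μ.map (fun ω => (Φ ω).contactDistance) = (volume.restrict (Ioi 0)).withDensity
        fun r => ENNReal.ofReal (poissonContactDensity lam r) := by
  have h1 := map_contactDistance (μ := μ) h.measurable (E := fun r => Real.pi * lam * r ^ 2)
    (p := fun r => 2 * Real.pi * lam * r) (by simp)
    (fun r _ => ((hasDerivAt_pow 2 r).const_mul (Real.pi * lam)).congr_deriv (by simp; ring))
    (fun r hr => by positivity)
    ((tendsto_pow_atTop two_ne_zero).const_mul_atTop (by positivity)) fun r hr => by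
      have hv : (ENNReal.ofReal lam • volume) (Metric.ball (0 : Plane) r) =
          ENNReal.ofReal (Real.pi * lam * r ^ 2) := by
        rw [Measure.smul_apply, EuclideanSpace.volume_ball_fin_two, smul_eq_mul,
          mul_right_comm, ENNReal.ofReal_mul (by positivity), ENNReal.ofReal_mul (by positivity),
          ENNReal.ofReal_pow hr.le, ← NNReal.coe_real_pi, ENNReal.ofReal_coe_nnreal]
        ring
      rw [h.measure_count_eq_zero Metric.isOpen_ball.measurableSet (by rw [hv]; simp), hv,
        negExp_ofReal (by positivity)]
  change IntegrableOn (fun r => poissonContactDensity lam r) (Ioi 0) ∧ _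
  simpa only [neg_mul, poissonContactDensity] using h1

lemma map_contactDistance_thomas [IsProbabilityMeasure μ] {Φ : Ω → Configuration}
    {lamP m σ : ℝ} (hlamP : 0 < lamP) (hm : 0 < m) (hσ : 0 < σ)
    (h : IsThomasProcess Φ lamP m σ μ) :
    IntegrableOn (thomasContactDensity lamP m σ) (Ioi 0) ∧
      μ.map (fun ω => (Φ ω).contactDistance) = (volume.restrict (Ioi 0)).withDensity
        fun r => ENNReal.ofReal (thomasContactDensity lamP m σ r) := by
  refine map_contactDistance (μ := μ) h.1
    (E := fun r => ∫ z in Ioi 0, thomasExponentIntegrand lamP m σ r z)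
    (p := fun r => ∫ z in Ioi 0, thomasPrefactorIntegrand lamP m σ r z) ?_
    (fun r _ => (hasDerivAt_integral_thomasExponentIntegrand hlamP hm hσ r).2) (fun r hr => ?_)
    (tendsto_integral_thomasExponentIntegrand hlamP hm hσ) fun r hr => ?_
  · simp [thomasExponentIntegrand_eq, riceCDF_zero]
  · exact setIntegral_nonneg measurableSet_Ioi fun z hz =>
      thomasPrefactorIntegrand_nonneg hlamP hm hσ hr hz
  · rw [h.measure_count_ball_eq_zero, lintegral_one_sub_negExp_clusterIntensity hlamP hm hσ hr.le,
      negExp_ofReal]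
    refine setIntegral_nonneg measurableSet_Ioi fun z hz => ?_
    exact thomasExponentIntegrand_nonneg hlamP hm r hz

/-! ### The order of the received powers -/

lemma poissonContactDensity_nonneg {lam r : ℝ} (hlam : 0 < lam) (hr : 0 < r) :
    0 ≤ poissonContactDensity lam r := by
  unfold poissonContactDensity; positivity

lemma mul_rpow_neg_lt_iff {p q β x y : ℝ} (hp : 0 < p) (hq : 0 < q) (hβ : 0 < β) (hx : 0 < x)
    (hy : 0 < y) : q * y ^ (-β) < p * x ^ (-β) ↔ (q / p) ^ (1 / β) * x < y := by
  have hxβ := Real.rpow_pos_of_pos hx β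
  have hyβ := Real.rpow_pos_of_pos hy β
  rw [Real.rpow_neg hx.le, Real.rpow_neg hy.le, ← div_eq_mul_inv, ← div_eq_mul_inv,
    ← Real.rpow_lt_rpow_iff (by positivity) hy.le hβ, Real.mul_rpow (by positivity) hx.le,
    ← Real.rpow_mul (by positivity), one_div_mul_cancel hβ.ne', Real.rpow_one,
    div_lt_div_iff₀ hyβ hxβ, div_mul_eq_mul_div, div_lt_iff₀ hp, mul_comm p]

/-- The region of contact distances in which the received powers are ordered. -/
def orderedRegion (c d : ℝ) : Set (ℝ × ℝ × ℝ) :=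
  {r | 0 < r.1 ∧ c * r.1 < r.2.1 ∧ d * r.2.1 < r.2.2}

lemma measurableSet_orderedRegion (c d : ℝ) : MeasurableSet (orderedRegion c d) :=
  (measurableSet_lt measurable_const measurable_fst).inter
    ((measurableSet_lt (measurable_fst.const_mul c) measurable_snd.fst).inter
      (measurableSet_lt (measurable_snd.fst.const_mul d) measurable_snd.snd))

lemma orderedRegion_subset {c d : ℝ} (hc : 0 < c) (hd : 0 < d) :
    orderedRegion c d ⊆ Ioi 0 ×ˢ Ioi 0 ×ˢ Ioi 0 := fun r ⟨h1, h2, h3⟩ => by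
  have h4 : 0 < r.2.1 := (mul_pos hc h1).trans h2
  exact ⟨h1, h4, (mul_pos hd h4).trans h3⟩

lemma integrableOn_prod_density {f g h : ℝ → ℝ} (hf : IntegrableOn f (Ioi 0))
    (hg : IntegrableOn g (Ioi 0)) (hh : IntegrableOn h (Ioi 0)) :
    IntegrableOn (fun r : ℝ × ℝ × ℝ => h r.2.2 * g r.2.1 * f r.1) (Ioi 0 ×ˢ Ioi 0 ×ˢ Ioi 0) := by
  have h1 : IntegrableOn (fun r : ℝ × ℝ × ℝ => f r.1 * (g r.2.1 * h r.2.2))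
      (Ioi 0 ×ˢ Ioi 0 ×ˢ Ioi 0) := by
    rw [IntegrableOn, Measure.volume_eq_prod, Measure.volume_eq_prod, ← Measure.prod_restrict,
      ← Measure.prod_restrict]
    exact hf.mul_prod (hg.mul_prod hh)
  exact h1.congr (ae_of_all _ fun r => by ring)

lemma setIntegral_orderedRegion {c d : ℝ} (hc : 0 < c) (hd : 0 < d) {f g h : ℝ → ℝ}
    (hf : IntegrableOn f (Ioi 0)) (hg : IntegrableOn g (Ioi 0)) (hh : IntegrableOn h (Ioi 0)) :
    ∫ r in orderedRegion c d, h r.2.2 * g r.2.1 * f r.1 =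
      ∫ x in Ioi (0 : ℝ), ∫ y in Ioi (c * x), ∫ z in Ioi (d * y), h z * g y * f x := by
  have hi := (integrableOn_prod_density hf hg hh).mono_set (orderedRegion_subset hc hd)
  rw [← integrable_indicator_iff (measurableSet_orderedRegion c d)] at hi
  rw [← integral_indicator (measurableSet_orderedRegion c d), Measure.volume_eq_prod,
    integral_prod _ hi, ← integral_indicator measurableSet_Ioi]
  refine integral_congr_ae (ae_of_all _ fun x => ?_)
  by_cases hx : x ∈ Ioi (0 : ℝ)
  swap
  · have : ∀ q : ℝ × ℝ, (x, q) ∉ orderedRegion c d := fun q hq => hx hq.1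
    simp [hx, this]
  have hx0 : 0 < x := hx
  let D : Set (ℝ × ℝ) := {q | c * x < q.1 ∧ d * q.1 < q.2}
  have hD : MeasurableSet D := (measurableSet_lt measurable_const measurable_fst).inter
    (measurableSet_lt (measurable_fst.const_mul d) measurable_snd)
  have hDsub : D ⊆ Ioi 0 ×ˢ Ioi 0 := fun q hq => by
    have h4 : 0 < q.1 := (mul_pos hc hx0).trans hq.1
    exact ⟨h4, (mul_pos hd h4).trans hq.2⟩
  have h1 : ∀ q : ℝ × ℝ, (orderedRegion c d).indicator
      (fun r : ℝ × ℝ × ℝ => h r.2.2 * g r.2.1 * f r.1) (x, q) =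
        D.indicator (fun q => h q.2 * g q.1 * f x) q := fun q => by
    have : (x, q) ∈ orderedRegion c d ↔ q ∈ D := and_iff_right hx0
    by_cases hq : q ∈ D
    · rw [indicator_of_mem hq, indicator_of_mem (this.2 hq)]
    · rw [indicator_of_notMem hq, indicator_of_notMem (mt this.1 hq)]
  have hi2 : IntegrableOn (fun q : ℝ × ℝ => h q.2 * g q.1 * f x) D := by
    refine IntegrableOn.mono_set ?_ hDsub
    have h2 : IntegrableOn (fun q : ℝ × ℝ => g q.1 * h q.2) (Ioi 0 ×ˢ Ioi 0) := by
      rw [IntegrableOn, Measure.volume_eq_prod, ← Measure.prod_restrict]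
      exact hg.mul_prod hh
    exact (h2.mul_const (f x)).congr (ae_of_all _ fun q => by ring)
  rw [← integrable_indicator_iff hD] at hi2
  simp only [h1, indicator_of_mem hx]
  rw [Measure.volume_eq_prod, integral_prod _ hi2, ← integral_indicator measurableSet_Ioi]
  refine integral_congr_ae (ae_of_all _ fun y => ?_)
  by_cases hy : y ∈ Ioi (c * x)
  · simp only [indicator_of_mem hy]
    rw [← integral_indicator measurableSet_Ioi]
    refine integral_congr_ae (ae_of_all _ fun z => ?_)
    have : (y, z) ∈ D ↔ z ∈ Ioi (d * y) := and_iff_right hy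
    by_cases hz : z ∈ Ioi (d * y)
    · simp only [indicator_of_mem hz, indicator_of_mem (this.2 hz)]
    · simp only [indicator_of_notMem hz, indicator_of_notMem (mt this.1 hz)]
  · have : ∀ z, (y, z) ∉ D := fun z hz => hy hz.1
    simp [hy, this]

/-- The probability of the ordered region for independent contact distances with densities. -/
lemma measureReal_orderedRegion [IsProbabilityMeasure μ] {c d : ℝ} (hc : 0 < c) (hd : 0 < d)
    {f g h : ℝ → ℝ} {X Y Z : Ω → ℝ} (hX : Measurable X) (hY : Measurable Y) (hZ : Measurable Z)
    (hYZ : IndepFun Y Z μ) (hXYZ : IndepFun X (fun ω => (Y ω, Z ω)) μ)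
    (hf : IntegrableOn f (Ioi 0)) (hg : IntegrableOn g (Ioi 0)) (hh : IntegrableOn h (Ioi 0))
    (hf0 : ∀ r, 0 < r → 0 ≤ f r) (hg0 : ∀ r, 0 < r → 0 ≤ g r) (hh0 : ∀ r, 0 < r → 0 ≤ h r)
    (hXf : μ.map X = (volume.restrict (Ioi 0)).withDensity fun r => ENNReal.ofReal (f r))
    (hYg : μ.map Y = (volume.restrict (Ioi 0)).withDensity fun r => ENNReal.ofReal (g r))
    (hZh : μ.map Z = (volume.restrict (Ioi 0)).withDensity fun r => ENNReal.ofReal (h r)) :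
    μ.real {ω | (X ω, Y ω, Z ω) ∈ orderedRegion c d} =
      ∫ r in orderedRegion c d, h r.2.2 * g r.2.1 * f r.1 := by
  have hD := measurableSet_orderedRegion c d
  have hsub := orderedRegion_subset hc hd
  have hfm := hf.1.aemeasurable.ennreal_ofReal
  have hgm := hg.1.aemeasurable.ennreal_ofReal
  have hhm := hh.1.aemeasurable.ennreal_ofReal
  have hlaw : μ.map (fun ω => (X ω, Y ω, Z ω)) =
      (volume.restrict (Ioi 0 ×ˢ Ioi 0 ×ˢ Ioi 0)).withDensity fun r : ℝ × ℝ × ℝ =>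
        ENNReal.ofReal (f r.1) * (ENNReal.ofReal (g r.2.1) * ENNReal.ofReal (h r.2.2)) := by
    rw [(indepFun_iff_map_prod_eq_prod_map_map hX.aemeasurable (hY.prodMk hZ).aemeasurable).1 hXYZ,
      (indepFun_iff_map_prod_eq_prod_map_map hY.aemeasurable hZ.aemeasurable).1 hYZ, hXf, hYg, hZh,
      prod_withDensity₀ hgm hhm, prod_withDensity₀ hfm (by
        exact (hgm.comp_fst).mul (hhm.comp_snd)),
      Measure.prod_restrict, Measure.prod_restrict]
    rfl
  have hmeas : Measurable fun ω => (X ω, Y ω, Z ω) := hX.prodMk (hY.prodMk hZ)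
  have hi := (integrableOn_prod_density hf hg hh).mono_set hsub
  rw [measureReal_def, show {ω | (X ω, Y ω, Z ω) ∈ orderedRegion c d} =
    (fun ω => (X ω, Y ω, Z ω)) ⁻¹' orderedRegion c d from rfl, ← Measure.map_apply hmeas hD, hlaw,
    withDensity_apply _ hD, Measure.restrict_restrict hD, inter_eq_left.2 hsub,
    integral_eq_lintegral_of_nonneg_ae _ hi.1]
  · congr 1
    refine setLIntegral_congr_fun hD fun r hr => ?_
    obtain ⟨h1, h2, h3⟩ := hsub hr
    rw [← ENNReal.ofReal_mul (hg0 _ h2), ← ENNReal.ofReal_mul (hf0 _ h1)]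
    congr 1; ring
  · filter_upwards [ae_restrict_mem hD] with r hr
    obtain ⟨h1, h2, h3⟩ := hsub hr
    exact mul_nonneg (mul_nonneg (hh0 _ h3) (hg0 _ h2)) (hf0 _ h1)

lemma thomasContactDensity_nonneg {lamP m σ r : ℝ} (hlamP : 0 < lamP) (hm : 0 < m) (hσ : 0 < σ)
    (hr : 0 < r) : 0 ≤ thomasContactDensity lamP m σ r :=
  mul_nonneg (setIntegral_nonneg measurableSet_Ioi fun _ hz =>
    thomasPrefactorIntegrand_nonneg hlamP hm hσ hr hz) (Real.exp_pos _).le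

end HetNet

theorem proposition1 {Ω : Type*} [MeasurableSpace Ω] (μ : Measure Ω) [IsProbabilityMeasure μ]
    (lam₁ lam₃ lamP m σ β : ℝ) (P : HetNet.Tier → ℝ)
    (hlam₁ : 0 < lam₁) (hlam₃ : 0 < lam₃) (hlamP : 0 < lamP) (hm : 0 < m) (hσ : 0 < σ)
    (hβ : 0 < β) (hP : ∀ l, 0 < P l)
    (Φ : HetNet.Tier → Ω → HetNet.Configuration)
    (hΦ₁ : HetNet.IsHomogeneousPoisson (Φ HetNet.Tier.one) lam₁ μ)
    (hΦ₂ : HetNet.IsThomasProcess (Φ HetNet.Tier.two) lamP m σ μ)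
    (hΦ₃ : HetNet.IsHomogeneousPoisson (Φ HetNet.Tier.three) lam₃ μ)
    (hindep : iIndepFun Φ μ)
    (i j k : HetNet.Tier) (hij : i ≠ j) (hjk : j ≠ k) (hik : i ≠ k) :
    (∀ r : ℝ, 0 < r →
      IntegrableOn (HetNet.thomasPrefactorIntegrand lamP m σ r) (Ioi 0) ∧
      IntegrableOn (HetNet.thomasExponentIntegrand lamP m σ r) (Ioi 0)) ∧
    IntegrableOn
      (fun r : ℝ × ℝ × ℝ =>
        HetNet.contactDensity lam₁ lam₃ lamP m σ k r.2.2 *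
          HetNet.contactDensity lam₁ lam₃ lamP m σ j r.2.1 *
          HetNet.contactDensity lam₁ lam₃ lamP m σ i r.1)
      {r : ℝ × ℝ × ℝ | 0 < r.1 ∧ (P j / P i) ^ (1 / β) * r.1 < r.2.1 ∧
        (P k / P j) ^ (1 / β) * r.2.1 < r.2.2} ∧
    μ.real {ω | HetNet.maxPower (P i) β (Φ i ω) > HetNet.maxPower (P j) β (Φ j ω) ∧
        HetNet.maxPower (P j) β (Φ j ω) > HetNet.maxPower (P k) β (Φ k ω)} =
      ∫ ri in Ioi (0 : ℝ), ∫ rj in Ioi ((P j / P i) ^ (1 / β) * ri),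
        ∫ rk in Ioi ((P k / P j) ^ (1 / β) * rj),
          HetNet.contactDensity lam₁ lam₃ lamP m σ k rk *
            HetNet.contactDensity lam₁ lam₃ lamP m σ j rj *
            HetNet.contactDensity lam₁ lam₃ lamP m σ i ri := by
  set f := HetNet.contactDensity lam₁ lam₃ lamP m σ
  have hmeas : ∀ l, Measurable (Φ l) := by
    rintro (_ | _ | _)
    exacts [hΦ₁.measurable, hΦ₂.1, hΦ₃.measurable]
  have hlaw : ∀ l, IntegrableOn (f l) (Ioi 0) ∧ μ.map (fun ω => (Φ l ω).contactDistance) =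
      (volume.restrict (Ioi 0)).withDensity fun r => ENNReal.ofReal (f l r) := by
    rintro (_ | _ | _)
    exacts [HetNet.map_contactDistance_poisson hlam₁ hΦ₁,
      HetNet.map_contactDistance_thomas hlamP hm hσ hΦ₂,
      HetNet.map_contactDistance_poisson hlam₃ hΦ₃]
  have hf0 : ∀ l r, 0 < r → 0 ≤ f l r := by
    rintro (_ | _ | _) r hr
    exacts [HetNet.poissonContactDensity_nonneg hlam₁ hr,
      HetNet.thomasContactDensity_nonneg hlamP hm hσ hr,
      HetNet.poissonContactDensity_nonneg hlam₃ hr]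
  have hT : ∀ l, Measurable fun ω => (Φ l ω).contactDistance := fun l =>
    HetNet.measurable_contactDistance.comp (hmeas l)
  have hpos : ∀ l, ∀ᵐ ω ∂μ, 0 < (Φ l ω).contactDistance := fun l => by
    have h : ∀ᵐ x ∂μ.map (fun ω => (Φ l ω).contactDistance), 0 < x := by
      rw [(hlaw l).2]
      exact (withDensity_absolutelyContinuous _ _).ae_le (ae_restrict_mem measurableSet_Ioi)
    exact ae_of_ae_map (hT l).aemeasurable h
  have hTind : iIndepFun (fun l ω => (Φ l ω).contactDistance) μ :=
    hindep.comp (fun _ => HetNet.Configuration.contactDistance)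
      fun _ => HetNet.measurable_contactDistance
  have hc : 0 < (P j / P i) ^ (1 / β) := Real.rpow_pos_of_pos (div_pos (hP j) (hP i)) _
  have hd : 0 < (P k / P j) ^ (1 / β) := Real.rpow_pos_of_pos (div_pos (hP k) (hP j)) _
  refine ⟨fun r _ => ⟨(HetNet.hasDerivAt_integral_thomasExponentIntegrand hlamP hm hσ r).1,
    HetNet.integrableOn_thomasExponentIntegrand hlamP hm hσ r⟩,
    (HetNet.integrableOn_prod_density (hlaw i).1 (hlaw j).1 (hlaw k).1).mono_set
      (HetNet.orderedRegion_subset hc hd), ?_⟩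
  rw [← HetNet.setIntegral_orderedRegion hc hd (hlaw i).1 (hlaw j).1 (hlaw k).1,
    ← HetNet.measureReal_orderedRegion hc hd (hT i) (hT j) (hT k) (hTind.indepFun hjk)
      (hTind.indepFun_prodMk hT j k i hij.symm hik.symm).symm (hlaw i).1 (hlaw j).1 (hlaw k).1
      (hf0 i) (hf0 j) (hf0 k) (hlaw i).2 (hlaw j).2 (hlaw k).2]
  refine measureReal_congr ?_
  filter_upwards [hpos i, hpos j, hpos k] with ω hi hj hk
  refine propext (and_congr ?_ ?_ |>.trans (and_iff_right hi).symm)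
  · exact HetNet.mul_rpow_neg_lt_iff (hP i) (hP j) hβ hi hj
  · exact HetNet.mul_rpow_neg_lt_iff (hP j) (hP k) hβ hj hk
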